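/- Let $X$ be a Riemannian manifold (possibly with boundary or corners) of dimension $D\ge 1$, with Riemannian distance $d$ and Riemannian volume $m$, let $\mu$ be a Borel probability measure on $X$, let $T:X\to X$ be measure preserving and ergodic for $\mu$, and let $p\in X$. Write $B(p,r)=\{x: d(x,p)<r\}$. For a sequence $(B_j)$ of sets put $E_n=\sum_{j=1}^n\mu(B_j)$. The sequence has the SBC (strong Borel–Cantelli) property if, for $\mu$-a.e. $x$, $\sum_{j=1}^n 1_{B_j}(T^jx)=E_n+o(E_n)$; it has the QSBC (quantitative SBC) property if, for every $\delta>0$ and $\mu$-a.e. $x$, $\sum_{j=1}^n 1_{B_j}(T^jx)=E_n+O(E_n^{1/2+\delta})$. We say that SBC (resp. QSBC) holds for nested balls about $p$ if every sequence $B_j=B(p,r_j)$ with $r_j>0$ non-increasing, $r_j\to0$ and $E_n\to\infty$ has the SBC (resp. QSBC) property. Assume that the density of $\mu$ at $p$ is bounded away from $0$ and $\infty$: there are constants $0<C_1<C_2<\infty$ such that $$C_1<\liminf_{r\to0^+}\frac{\mu(B(p,r))}{m(B(p,r))},\qquad \limsup_{r\to0^+}\frac{\mu(B(p,r))}{m(B(p,r))}<C_2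 ,$$ and that SBC holds for nested balls about $p$. Let $k$ be real, $\varphi(x)=d(x,p)^{-k}$ (with $\varphi(p)=\infty$) and $S_n=\sum_{j=0}^{n-1}\varphi\circ T^j$. If $k>D$, then (a) for every $\varepsilon>0$, $\displaystyle\limsup_{n\to\infty}\frac{S_n}{n^{k/D}(\log n)^{k/D+\varepsilon}}=0$ $\mu$-a.e.; (b) for every $\varepsilon>0$, $\displaystyle\liminf_{n\to\infty}\frac{S_n}{n^{k/D-\varepsilon}}\ge1$ $\mu$-a.e.; (c) for $\mu$-a.e. $x$, $S_n(x)\ge n^{k/D}(\log n)^{k/D}$ for infinitely many $n$; (d) if moreover QSBC holds for nested balls about $p$, then for every $\varepsilon>0$, $\displaystyle\liminf_{n\to\infty}\frac{S_n}{\bigl(n\,e^{-(\log n)^{1/2+\varepsilon}}\bigr)^{k/D}}>1$ $\mu$-a.e. If $k=D$, then (a) and (c) hold, and there is a constant $\delta>0$ such that $\displaystyle\liminf_{n\to\infty}\frac{S_n}{n}>\delta$ $\mu$-a.e. -/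

import Mathlib

open MeasureTheory Filter Set Bundle
open scoped Topology ENNReal Manifold

noncomputable section

namespace BirkhoffGrowth

/-- The observable `φ(x) = d(x,p)^{-k}`, with values in `[0,∞]` (and `φ(p) = ∞` when `k > 0`). -/
def obs {X : Type*} [MetricSpace X] (p : X) (k : ℝ) (x : X) : ℝ≥0∞ :=
  edist x p ^ (-k)

/-- The Birkhoff sum `S_n = ∑_{j=0}^{n-1} φ ∘ T^j` of `φ(x) = d(x,p)^{-k}`. -/
def S {X : Type*} [MetricSpace X] (T : X → X) (p : X) (k : ℝ) (n : ℕ) (x : X) : ℝ≥0∞ :=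
  ∑ j ∈ Finset.range n, obs p k (T^[j] x)

/-- `E_n = ∑_{j=1}^n μ(B_j)`. -/
def expectedHits {X : Type*} [MeasurableSpace X] (μ : Measure X) (B : ℕ → Set X) (n : ℕ) : ℝ :=
  ∑ j ∈ Finset.Icc 1 n, μ.real (B j)

/-- `∑_{j=1}^n 1_{B_j} ∘ T^j (x)`. -/
def hits {X : Type*} (T : X → X) (B : ℕ → Set X) (n : ℕ) (x : X) : ℝ :=
  ∑ j ∈ Finset.Icc 1 n, (B j).indicator (fun _ => (1 : ℝ)) (T^[j] x)

/-- The strong Borel–Cantelli property of a sequence of sets: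
`∑_{j=1}^n 1_{B_j} ∘ T^j (x) = E_n + o(E_n)` for almost every `x`. -/
def SBC {X : Type*} [MeasurableSpace X] (T : X → X) (μ : Measure X) (B : ℕ → Set X) : Prop :=
  ∀ᵐ x ∂μ, (fun n => hits T B n x - expectedHits μ B n) =o[atTop] expectedHits μ B

/-- The quantitative strong Borel–Cantelli property of a sequence of sets: for every `δ > 0`,
`∑_{j=1}^n 1_{B_j} ∘ T^j (x) = E_n + O(E_n^{1/2+δ})` for almost every `x`. -/
def QSBC {X : Type*} [MeasurableSpace X] (T : X → X) (μ : Measure X) (B : ℕ → Set X) : Prop :=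
  ∀ δ : ℝ, 0 < δ → ∀ᵐ x ∂μ,
    (fun n => hits T B n x - expectedHits μ B n) =O[atTop]
      fun n => expectedHits μ B n ^ (1 / 2 + δ)

/-- `(B_j)` is a sequence of nested open balls centred at `p`, with radii decreasing to `0`. -/
def NestedBalls {X : Type*} [MetricSpace X] (p : X) (B : ℕ → Set X) : Prop :=
  ∃ r : ℕ → ℝ, (∀ j, 0 < r j) ∧ Antitone r ∧ Tendsto r atTop (𝓝 0) ∧
    ∀ j, B j = Metric.ball p (r j)

/-- The SBC property for nested balls about `p`. As always in dynamical Borel–Cantelli lemmas, only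
sequences with `∑ μ(B_j) = ∞` are considered. -/
def SBCAt {X : Type*} [MetricSpace X] [MeasurableSpace X] (T : X → X) (μ : Measure X) (p : X) :
    Prop :=
  ∀ B : ℕ → Set X, NestedBalls p B → Tendsto (expectedHits μ B) atTop atTop → SBC T μ B

/-- The QSBC property for nested balls about `p` (for sequences with `∑ μ(B_j) = ∞`). -/
def QSBCAt {X : Type*} [MetricSpace X] [MeasurableSpace X] (T : X → X) (μ : Measure X) (p : X) :
    Prop :=
  ∀ B : ℕ → Set X, NestedBalls p B → Tendsto (expectedHits μ B) atTop atTop → QSBC T μ B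

/-- The lower derivative of `μ` with respect to `m` at the point `p`. When `dμ/dm` has a value at
`p` as a derivative of measures (for instance, when it has a version continuous at `p`), this is
that value. -/
def lowerDensity {X : Type*} [MetricSpace X] [MeasurableSpace X] (μ m : Measure X) (p : X) :
    ℝ≥0∞ :=
  liminf (fun r : ℝ => μ (Metric.ball p r) / m (Metric.ball p r)) (𝓝[>] 0)

/-- The upper derivative of `μ` with respect to `m` at the point `p`. -/
def upperDensity {X : Type*} [MetricSpace X] [MeasurableSpace X] (μ m : Measure X) (p : X) :
    ℝ≥0∞ :=
  limsup (fun r : ℝ => μ (Metric.ball p r) / m (Metric.ball p r)) (𝓝[>] 0)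

end BirkhoffGrowth

/-!
Bi-Lipschitz charts give `m (B(p, r)) ≍ r ^ D`, hence `μ (B(p, r)) ≍ r ^ D` by the density
assumption.

Upper bound: the gauge `y ^ (D / k) / (log (e + y)) ^ q` is subadditive when `k ≥ D`, and for
`q > 1` its composition with `φ` is integrable. By the maximal ergodic theorem the Birkhoff sums of
the composition are `O(n)`, hence so is the gauge of `S_n`.

Lower bounds: if `μ (B_j) ≍ v_j`, then each visit `T^j x ∈ B_j` with `m < j ≤ n` contributes at
least `v_m ^ (-k / D)` to `S_{n+1}`. With `v_j = j ^ (η - 1)` SBC gives `≍ n ^ η` visits after time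
`n / 2`, whence (b) and the bound for `k = D`; with `v_j = 1 / (j log j)` it gives infinitely many
visits, whence (c). With `v_j = 1 / j` we have `E_n ≍ log n`, and QSBC forces a visit after the time
`n * exp (-(log n) ^ (1 / 2 + ε) / 2)`, whence (d).
-/

namespace BirkhoffGrowth

section Charts

open Manifold
open scoped NNReal

attribute [local instance] normedAddCommGroupTangentSpaceVectorSpace
attribute [local instance] normedSpaceTangentSpaceVectorSpace

theorem pathELength_comp_le {E : Type*} [NormedAddCommGroup E] [NormedSpace ℝ E]
    {H : Type*} [TopologicalSpace H] {I : ModelWithCorners ℝ E H}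
    {M : Type*} [TopologicalSpace M] [ChartedSpace H M] [∀ x : M, ENorm (TangentSpace I x)]
    {E' : Type*} [NormedAddCommGroup E'] [NormedSpace ℝ E']
    {H' : Type*} [TopologicalSpace H'] {I' : ModelWithCorners ℝ E' H'}
    {M' : Type*} [TopologicalSpace M'] [ChartedSpace H' M'] [∀ x : M', ENorm (TangentSpace I' x)]
    {f : M → M'} {s : Set M} {γ : ℝ → M} {a b : ℝ} {C : ℝ≥0}
    (hγ : ∀ t ∈ Ioo a b, MDifferentiableAt 𝓘(ℝ, ℝ) I γ t)
    (hγs : MapsTo γ (Ioo a b) s)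
    (hf : ∀ t ∈ Ioo a b, MDifferentiableWithinAt I I' f s (γ t))
    (hC : ∀ t ∈ Ioo a b, ∀ v : TangentSpace I (γ t),
      ‖mfderivWithin I I' f s (γ t) v‖ₑ ≤ C * ‖v‖ₑ) :
    pathELength I' (f ∘ γ) a b ≤ C * pathELength I γ a b := by
  rw [pathELength_eq_lintegral_mfderiv_Ioo, pathELength_eq_lintegral_mfderiv_Ioo,
    ← lintegral_const_mul' _ _ ENNReal.coe_ne_top]
  refine setLIntegral_mono' measurableSet_Ioo fun t ht => ?_
  have hchain : mfderiv 𝓘(ℝ, ℝ) I' (f ∘ γ) t =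
      (mfderivWithin I I' f s (γ t)).comp (mfderiv 𝓘(ℝ, ℝ) I γ t) := by
    rw [← mfderivWithin_of_isOpen isOpen_Ioo ht, ← mfderivWithin_of_isOpen isOpen_Ioo ht]
    exact mfderivWithin_comp t (hf t ht) (hγ t ht).mdifferentiableWithinAt hγs
      (isOpen_Ioo.uniqueMDiffWithinAt ht)
  rw [hchain]
  exact hC t ht _

section NormedSpace

variable {E : Type*} [NormedAddCommGroup E] [NormedSpace ℝ E]

theorem pathELength_lineMap (x y : E) :
    pathELength 𝓘(ℝ, E) (ContinuousAffineMap.lineMap (R := ℝ) x y) 0 1 = edist x y := by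
  rw [← lintegral_fderiv_lineMap_eq_edist, pathELength_eq_lintegral_mfderivWithin_Icc]
  simp only [mfderivWithin_eq_fderivWithin]
  rfl

theorem edist_le_pathELength {γ : ℝ → E} {a b : ℝ} (hab : a ≤ b)
    (hγ : ContDiffOn ℝ 1 γ (Icc a b)) :
    edist (γ a) (γ b) ≤ pathELength 𝓘(ℝ, E) γ a b := by
  rw [edist_comm, edist_eq_enorm_sub, pathELength_eq_lintegral_mfderivWithin_Icc]
  refine (enorm_sub_le_lintegral_derivWithin_Icc_of_contDiffOn_Icc hγ hab).trans_eq ?_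
  simp only [← fderivWithin_derivWithin, mfderivWithin_eq_fderivWithin]
  rfl

end NormedSpace

variable {E : Type*} [NormedAddCommGroup E] [NormedSpace ℝ E]
  {H : Type*} [TopologicalSpace H] {I : ModelWithCorners ℝ E H}
  {X : Type*} [PseudoEMetricSpace X] [ChartedSpace H X]
  [RiemannianBundle (fun x : X => TangentSpace I x)] [IsRiemannianManifold I X]
  {F : Type*} [NormedAddCommGroup F] [NormedSpace ℝ F]

theorem edist_le_pathELength_of_mem_Icc {γ : ℝ → X} {a b t : ℝ}
    (hγ : ContMDiffOn 𝓘(ℝ, ℝ) I 1 γ (Icc a b)) (ht : t ∈ Icc a b) :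
    edist (γ a) (γ t) ≤ pathELength I γ a b := by
  rw [IsRiemannianManifold.out (I := I)]
  exact (riemannianEDist_le_pathELength (hγ.mono (Icc_subset_Icc_right ht.2)) rfl rfl ht.1).trans
    (pathELength_mono le_rfl ht.2)

theorem lipschitzOnWith_of_convex_of_enorm_mfderivWithin_le {f : F → X} {s : Set F} {C : ℝ≥0}
    (hs : Convex ℝ s) (hf : ContMDiffOn 𝓘(ℝ, F) I 1 f s)
    (hC : ∀ x ∈ s, ∀ v : TangentSpace 𝓘(ℝ, F) x,
      ‖mfderivWithin 𝓘(ℝ, F) I f s x v‖ₑ ≤ C * ‖v‖ₑ) :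
    LipschitzOnWith C f s := by
  intro x hx y hy
  let γ : ℝ →ᴬ[ℝ] F := ContinuousAffineMap.lineMap x y
  have hγs : MapsTo γ (Icc 0 1) s := fun t ht => hs.lineMap_mem hx hy ht
  have hγ : ContMDiff 𝓘(ℝ, ℝ) 𝓘(ℝ, F) 1 γ := contMDiff_iff_contDiff.2 γ.contDiff
  calc edist (f x) (f y) = edist ((f ∘ γ) 0) ((f ∘ γ) 1) := by
        simp [γ, ContinuousAffineMap.coe_lineMap_eq]
    _ ≤ pathELength I (f ∘ γ) 0 1 :=
        edist_le_pathELength_of_mem_Icc (hf.comp hγ.contMDiffOn hγs) (right_mem_Icc.2 zero_le_one)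
    _ ≤ C * pathELength 𝓘(ℝ, F) γ 0 1 := by
        have hmem : ∀ t ∈ Ioo (0 : ℝ) 1, γ t ∈ s := fun t ht => hγs (Ioo_subset_Icc_self ht)
        exact pathELength_comp_le (fun t _ => hγ.mdifferentiableAt one_ne_zero) hmem
          (fun t ht => hf.mdifferentiableOn one_ne_zero _ (hmem t ht))
          fun t ht => hC _ (hmem t ht)
    _ = C * edist x y := by rw [pathELength_lineMap]

theorem lipschitzOnWith_eball_of_enorm_mfderivWithin_le {f : X → F} {p : X} {r : ℝ≥0∞} {C : ℝ≥0}
    (hf : ContMDiffOn I 𝓘(ℝ, F) 1 f (Metric.eball p (3 * r)))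
    (hC : ∀ x ∈ Metric.eball p (3 * r), ∀ v : TangentSpace I x,
      ‖mfderivWithin I 𝓘(ℝ, F) f (Metric.eball p (3 * r)) x v‖ₑ ≤ C * ‖v‖ₑ) :
    LipschitzOnWith C f (Metric.eball p r) := by
  intro x hx y hy
  have hxy : edist x y < r + r :=
    (edist_triangle_right x y p).trans_lt (ENNReal.add_lt_add hx hy)
  have hshort : ∀ l ∈ Ioo (edist x y) (r + r), edist (f x) (f y) ≤ C * l := by
    rintro l ⟨hl, hlr⟩
    rw [IsRiemannianManifold.out (I := I)] at hl
    obtain ⟨γ, rfl, rfl, hγ, hγl⟩ := exists_lt_of_riemannianEDist_lt hl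
    have hmem : MapsTo γ (Icc 0 1) (Metric.eball p (3 * r)) := fun t ht => by
      have hdist : edist (γ 0) (γ t) < r + r :=
        (edist_le_pathELength_of_mem_Icc hγ ht).trans_lt (hγl.trans hlr)
      calc edist (γ t) p ≤ edist (γ 0) (γ t) + edist (γ 0) p := edist_triangle_left _ _ _
        _ < (r + r) + r := ENNReal.add_lt_add hdist hx
        _ = 3 * r := by ring
    have hmem' : ∀ t ∈ Ioo (0 : ℝ) 1, γ t ∈ Metric.eball p (3 * r) :=
      fun t ht => hmem (Ioo_subset_Icc_self ht)
    calc edist (f (γ 0)) (f (γ 1)) ≤ pathELength 𝓘(ℝ, F) (f ∘ γ) 0 1 :=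
          edist_le_pathELength zero_le_one (contMDiffOn_iff_contDiffOn.1 (hf.comp hγ hmem))
      _ ≤ C * pathELength I γ 0 1 := by
          refine pathELength_comp_le (fun t ht => ?_) hmem'
            (fun t ht => hf.mdifferentiableOn one_ne_zero _ (hmem' t ht))
            fun t ht => hC _ (hmem' t ht)
          exact (hγ.contMDiffAt (Icc_mem_nhds ht.1 ht.2)).mdifferentiableAt one_ne_zero
      _ ≤ C * l := by gcongr
  have : (𝓝[>] edist x y).NeBot := nhdsGT_neBot_of_exists_gt ⟨_, hxy⟩
  have hlim : Tendsto (fun l : ℝ≥0∞ => C * l) (𝓝[>] edist x y) (𝓝 (C * edist x y)) :=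
    (ENNReal.Tendsto.const_mul tendsto_id (Or.inr ENNReal.coe_ne_top)).mono_left nhdsWithin_le_nhds
  exact ge_of_tendsto hlim (mem_of_superset (Ioo_mem_nhdsGT hxy) hshort)

variable (I) [IsManifold I 1 X] [IsContinuousRiemannianBundle E (fun x : X => TangentSpace I x)]

theorem exists_lipschitzOnWith_extChartAt_symm (p : X) :
    ∃ C : ℝ≥0, 0 < C ∧ ∃ r > 0,
      Metric.ball (extChartAt I p p) r ∩ range I ⊆ (extChartAt I p).target ∧
      LipschitzOnWith C (extChartAt I p).symm (Metric.ball (extChartAt I p p) r ∩ range I) := by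
  obtain ⟨C, hC₀, hC⟩ := eventually_enorm_mfderivWithin_symm_extChartAt_lt I p
  obtain ⟨r, hr₀, hr⟩ :=
    Metric.mem_nhdsWithin_iff.1 (inter_mem (extChartAt_target_mem_nhdsWithin p) hC)
  refine ⟨C, hC₀, r, hr₀, fun x hx => (hr hx).1, ?_⟩
  refine lipschitzOnWith_of_convex_of_enorm_mfderivWithin_le
    ((convex_ball _ _).inter I.convex_range)
    ((contMDiffOn_extChartAt_symm p).mono fun x hx => (hr hx).1) fun x hx v => ?_
  rw [inter_comm, mfderivWithin_inter (Metric.isOpen_ball.mem_nhds hx.1)]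
  exact (ContinuousLinearMap.le_opENorm _ _).trans (mul_le_mul_left (hr hx).2.le _)

theorem exists_lipschitzOnWith_extChartAt (p : X) :
    ∃ C : ℝ≥0, 0 < C ∧ ∃ U ∈ 𝓝 p, U ⊆ (extChartAt I p).source ∧
      LipschitzOnWith C (extChartAt I p) U := by
  obtain ⟨C, hC₀, hC⟩ := eventually_enorm_mfderiv_extChartAt_lt I p
  obtain ⟨R, hR₀, hR⟩ :=
    EMetric.mem_nhds_iff.1 (inter_mem (extChartAt_source_mem_nhds (I := I) p) hC)
  have hthird : 3 * (R / 3) = R := ENNReal.mul_div_cancel (by simp) (by simp)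
  have hsub : Metric.eball p (R / 3) ⊆ Metric.eball p R :=
    Metric.eball_subset_eball
      ((le_mul_of_one_le_left zero_le (by norm_num)).trans_eq hthird)
  refine ⟨C, hC₀, Metric.eball p (R / 3),
    Metric.eball_mem_nhds _ (ENNReal.div_pos hR₀.ne' (by simp)),
    fun x hx => (hR (hsub hx)).1, lipschitzOnWith_eball_of_enorm_mfderivWithin_le (I := I) ?_ ?_⟩
  · rw [hthird]
    refine contMDiffOn_extChartAt.mono fun x hx => ?_
    rw [← extChartAt_source I]
    exact (hR hx).1
  · rw [hthird]
    intro x hx v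
    rw [mfderivWithin_of_isOpen Metric.isOpen_eball hx]
    exact (ContinuousLinearMap.le_opENorm _ _).trans (mul_le_mul_left (hR hx).2.le _)

end Charts

section Volume

open scoped NNReal
open Asymptotics

theorem euclideanHausdorffMeasure_image_le {X Y : Type*} [EMetricSpace X] [MeasurableSpace X]
    [BorelSpace X] [EMetricSpace Y] [MeasurableSpace Y] [BorelSpace Y] {f : X → Y} {K : ℝ≥0}
    {s : Set X} (hf : LipschitzOnWith K f s) (d : ℕ) :
    (μHE[d] : Measure Y) (f '' s) ≤ K ^ d * (μHE[d] : Measure X) s := by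
  simp only [Measure.euclideanHausdorffMeasure_def, Measure.smul_apply, ENNReal.smul_def,
    smul_eq_mul]
  rw [mul_left_comm, ← ENNReal.rpow_natCast]
  gcongr
  exact hf.hausdorffMeasure_image_le (Nat.cast_nonneg d)

theorem ball_inter_subset_image_ball {X Y : Type*} [PseudoMetricSpace X] [PseudoMetricSpace Y]
    {e : PartialEquiv X Y} {K : ℝ≥0} {s : Set Y} {p : X} (hK : 0 < K)
    (he : LipschitzOnWith K e.symm s) (hs : s ⊆ e.target) (hp : p ∈ e.source) (hps : e p ∈ s)
    (r : ℝ) : Metric.ball (e p) (r / K) ∩ s ⊆ e '' Metric.ball p r := by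
  rintro y ⟨hy, hys⟩
  refine ⟨e.symm y, ?_, e.right_inv (hs hys)⟩
  have hdist := he.dist_le_mul y hys (e p) hps
  rw [e.left_inv hp] at hdist
  exact hdist.trans_lt ((lt_div_iff₀' (NNReal.coe_pos.2 hK)).1 hy)

section Convex

variable {E : Type*} [NormedAddCommGroup E] [NormedSpace ℝ E] {s : Set E} {c : E}

theorem addHaar_ball_inter_pos_of_convex [MeasurableSpace E] (ν : Measure E)
    [ν.IsOpenPosMeasure] (hs : Convex ℝ s) (hint : (interior s).Nonempty) (hc : c ∈ s) {r : ℝ}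
    (hr : 0 < r) : 0 < ν (Metric.ball c r ∩ s) := by
  have hcl : c ∈ closure (interior s) := by
    rw [hs.closure_interior_eq_closure_of_nonempty_interior hint]
    exact subset_closure hc
  have hne : (Metric.ball c r ∩ interior s).Nonempty :=
    mem_closure_iff.1 hcl _ Metric.isOpen_ball (Metric.mem_ball_self hr)
  exact ((Metric.isOpen_ball.inter isOpen_interior).measure_pos ν hne).trans_le
    (measure_mono (inter_subset_inter_right _ interior_subset))

theorem ofReal_pow_mul_addHaar_ball_inter_le [FiniteDimensional ℝ E] [MeasurableSpace E]
    [BorelSpace E] (ν : Measure E) [ν.IsAddHaarMeasure] (hs : Convex ℝ s) (hc : c ∈ s) {r : ℝ}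
    (hr₀ : 0 < r) (hr₁ : r ≤ 1) :
    ENNReal.ofReal (r ^ Module.finrank ℝ E) * ν (Metric.ball c 1 ∩ s) ≤
      ν (Metric.ball c r ∩ s) := by
  have himage : AffineMap.homothety c r '' (Metric.ball c 1 ∩ s) ⊆ Metric.ball c r ∩ s := by
    rintro _ ⟨y, ⟨hy, hys⟩, rfl⟩
    refine ⟨?_, hs.lineMap_mem hc hys ⟨hr₀.le, hr₁⟩⟩
    rw [Metric.mem_ball, dist_homothety_center, Real.norm_of_nonneg hr₀.le, dist_comm]
    exact mul_lt_of_lt_one_right hr₀ hy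
  have hscale := Measure.addHaar_image_homothety ν c r (Metric.ball c 1 ∩ s)
  rw [abs_of_pos (pow_pos hr₀ _)] at hscale
  exact hscale.symm.trans_le (measure_mono himage)

end Convex

section LipschitzChart

variable {E : Type*} [NormedAddCommGroup E] [NormedSpace ℝ E] [FiniteDimensional ℝ E]
  {X : Type*} [MetricSpace X] [MeasurableSpace X] [BorelSpace X] {φ : PartialEquiv X E} {p : X}
  {U : Set X} {A B : ℝ≥0}

theorem exists_eventually_euclideanHausdorffMeasure_ball_le (hU : U ∈ 𝓝 p) (hUs : U ⊆ φ.source)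
    (hA : LipschitzOnWith A φ.symm (φ '' U)) (hB : LipschitzOnWith B φ U) :
    ∃ K : ℝ≥0, ∀ᶠ r : ℝ in 𝓝[>] 0, (μHE[Module.finrank ℝ E] : Measure X) (Metric.ball p r) ≤
      K * ENNReal.ofReal (r ^ Module.finrank ℝ E) := by
  borelize E
  set n := Module.finrank ℝ E
  set ν : Measure E := μHE[n]
  refine ⟨A ^ n * (B ^ n * (ν (Metric.ball 0 1)).toNNReal), ?_⟩
  filter_upwards [nhdsWithin_le_nhds (eventually_closedBall_subset hU), self_mem_nhdsWithin]
    with r hrU hr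
  replace hrU := Metric.ball_subset_closedBall.trans hrU
  have himage : φ '' Metric.ball p r ⊆ Metric.closedBall (φ p) (B * r) := by
    rintro _ ⟨x, hx, rfl⟩
    exact (hB.dist_le_mul x (hrU hx) p (mem_of_mem_nhds hU)).trans
      (mul_le_mul_of_nonneg_left (Metric.mem_ball.1 hx).le B.coe_nonneg)
  calc (μHE[n] : Measure X) (Metric.ball p r)
      = (μHE[n] : Measure X) (φ.symm '' (φ '' Metric.ball p r)) := by
        rw [φ.symm_image_image_of_subset_source (hrU.trans hUs)]
    _ ≤ A ^ n * ν (φ '' Metric.ball p r) :=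
        euclideanHausdorffMeasure_image_le (hA.mono (image_mono hrU)) n
    _ ≤ A ^ n * ν (Metric.closedBall (φ p) (B * r)) := by gcongr
    _ = (A ^ n * (B ^ n * (ν (Metric.ball 0 1)).toNNReal) : ℝ≥0) * ENNReal.ofReal (r ^ n) := by
        rw [Measure.addHaar_closedBall ν _ (mul_nonneg B.coe_nonneg (le_of_lt hr)), mul_pow,
          ENNReal.ofReal_mul (pow_nonneg B.coe_nonneg _), ENNReal.ofReal_pow B.coe_nonneg,
          ENNReal.ofReal_coe_nnreal]
        push_cast
        rw [ENNReal.coe_toNNReal measure_ball_lt_top.ne]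
        ring

theorem exists_eventually_le_euclideanHausdorffMeasure_ball {s : Set E} {ρ : ℝ} (hs : Convex ℝ s)
    (hint : (interior s).Nonempty) (hp : p ∈ φ.source) (hps : φ p ∈ s) (hρ : 0 < ρ)
    (hρt : Metric.ball (φ p) ρ ∩ s ⊆ φ.target) (hA₀ : 0 < A)
    (hA : LipschitzOnWith A φ.symm (Metric.ball (φ p) ρ ∩ s)) (hU : U ∈ 𝓝 p)
    (hB : LipschitzOnWith B φ U) :
    ∃ K : ℝ≥0, ∀ᶠ r : ℝ in 𝓝[>] 0, ENNReal.ofReal (r ^ Module.finrank ℝ E) ≤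
      K * (μHE[Module.finrank ℝ E] : Measure X) (Metric.ball p r) := by
  borelize E
  set n := Module.finrank ℝ E
  set ν : Measure E := μHE[n]
  set v := ν (Metric.ball (φ p) 1 ∩ s)
  have hv₀ : 0 < v := addHaar_ball_inter_pos_of_convex ν hs hint hps one_pos
  have hv : v ≠ ∞ := ((measure_mono inter_subset_left).trans_lt measure_ball_lt_top).ne
  refine ⟨A ^ n * B ^ n * v.toNNReal⁻¹, ?_⟩
  have hA₀' : (0 : ℝ) < A := hA₀
  have hsmall : Iic (min (A : ℝ) (A * ρ)) ∈ 𝓝[>] (0 : ℝ) :=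
    nhdsWithin_le_nhds (Iic_mem_nhds (by positivity))
  filter_upwards [nhdsWithin_le_nhds (eventually_closedBall_subset hU), self_mem_nhdsWithin, hsmall]
    with r hrU hr hrA
  have hr : 0 < r := hr
  have hrA : r / A ≤ 1 ∧ r / A ≤ ρ := by
    simpa [div_le_iff₀' hA₀'] using hrA
  have hrU : Metric.ball p r ⊆ U := Metric.ball_subset_closedBall.trans hrU
  have himage : Metric.ball (φ p) (r / A) ∩ s ⊆ φ '' Metric.ball p r :=
    (subset_inter inter_subset_left
      (inter_subset_inter_left _ (Metric.ball_subset_ball hrA.2))).trans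
      (ball_inter_subset_image_ball hA₀ hA hρt hp ⟨Metric.mem_ball_self hρ, hps⟩ r)
  have hvol : ENNReal.ofReal ((r / A) ^ n) * v ≤ B ^ n * (μHE[n] : Measure X) (Metric.ball p r) :=
    ((ofReal_pow_mul_addHaar_ball_inter_le ν hs hps (by positivity) hrA.1).trans
      (measure_mono himage)).trans (euclideanHausdorffMeasure_image_le (hB.mono hrU) n)
  have hpow : ENNReal.ofReal (r ^ n) = A ^ n * ENNReal.ofReal ((r / A) ^ n) := by
    rw [← ENNReal.ofReal_coe_nnreal, ← ENNReal.ofReal_pow A.coe_nonneg,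
      ← ENNReal.ofReal_mul (by positivity), ← mul_pow, mul_div_cancel₀ _ hA₀'.ne']
  calc ENNReal.ofReal (r ^ n)
      = A ^ n * (ENNReal.ofReal ((r / A) ^ n) * v) * v⁻¹ := by
        rw [← mul_assoc, ENNReal.mul_inv_cancel_right hv₀.ne' hv, hpow]
    _ ≤ A ^ n * (B ^ n * (μHE[n] : Measure X) (Metric.ball p r)) * v⁻¹ := by gcongr
    _ = (A ^ n * B ^ n * v.toNNReal⁻¹ : ℝ≥0) * (μHE[n] : Measure X) (Metric.ball p r) := by
        push_cast [ENNReal.coe_inv (ENNReal.toNNReal_pos hv₀.ne' hv).ne', ENNReal.coe_toNNReal hv]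
        ring

end LipschitzChart

theorem isTheta_measureReal_ball_of_eventually_le {X : Type*} [PseudoMetricSpace X]
    [MeasurableSpace X] {m : Measure X} {p : X} {n : ℕ} {K L : ℝ≥0}
    (hK : ∀ᶠ r : ℝ in 𝓝[>] 0, m (Metric.ball p r) ≤ K * ENNReal.ofReal (r ^ n))
    (hL : ∀ᶠ r : ℝ in 𝓝[>] 0, ENNReal.ofReal (r ^ n) ≤ L * m (Metric.ball p r)) :
    (fun r => m.real (Metric.ball p r)) =Θ[𝓝[>] 0] fun r => r ^ n := by
  constructor
  · refine IsBigO.of_bound K ?_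
    filter_upwards [hK, self_mem_nhdsWithin] with r hKr hr
    have hpow : 0 ≤ r ^ n := pow_nonneg (le_of_lt hr) _
    rw [Real.norm_of_nonneg measureReal_nonneg, Real.norm_of_nonneg hpow]
    refine ENNReal.toReal_le_of_le_ofReal (by positivity) (hKr.trans_eq ?_)
    rw [ENNReal.ofReal_mul K.coe_nonneg, ENNReal.ofReal_coe_nnreal]
  · refine IsBigO.of_bound L ?_
    filter_upwards [hL, hK, self_mem_nhdsWithin] with r hLr hKr hr
    have hpow : 0 ≤ r ^ n := pow_nonneg (le_of_lt hr) _
    have hfin : m (Metric.ball p r) ≠ ∞ := ne_top_of_le_ne_top (by finiteness) hKr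
    rw [Real.norm_of_nonneg measureReal_nonneg, Real.norm_of_nonneg hpow]
    refine (ENNReal.ofReal_le_ofReal_iff (by positivity)).1 (hLr.trans_eq ?_)
    rw [ENNReal.ofReal_mul L.coe_nonneg, ENNReal.ofReal_coe_nnreal, ofReal_measureReal hfin]

theorem isTheta_real_euclideanHausdorffMeasure_ball
    {E : Type*} [NormedAddCommGroup E] [NormedSpace ℝ E] [FiniteDimensional ℝ E]
    {H : Type*} [TopologicalSpace H] (I : ModelWithCorners ℝ E H)
    {X : Type*} [MetricSpace X] [ChartedSpace H X] [IsManifold I 1 X]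
    [RiemannianBundle (fun x : X => TangentSpace I x)]
    [IsContinuousRiemannianBundle E (fun x : X => TangentSpace I x)]
    [IsRiemannianManifold I X] [MeasurableSpace X] [BorelSpace X] (p : X) :
    (fun r => (μHE[Module.finrank ℝ E] : Measure X).real (Metric.ball p r)) =Θ[𝓝[>] 0]
      fun r => r ^ Module.finrank ℝ E := by
  obtain ⟨A, hA₀, ρ, hρ, hρt, hA⟩ := exists_lipschitzOnWith_extChartAt_symm I p
  obtain ⟨B, -, U, hU, hUs, hB⟩ := exists_lipschitzOnWith_extChartAt I p
  have hV : U ∩ extChartAt I p ⁻¹' Metric.ball (extChartAt I p p) ρ ∈ 𝓝 p :=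
    inter_mem hU ((continuousAt_extChartAt p).preimage_mem_nhds (Metric.ball_mem_nhds _ hρ))
  have hVρ : extChartAt I p '' (U ∩ extChartAt I p ⁻¹' Metric.ball (extChartAt I p p) ρ) ⊆
      Metric.ball (extChartAt I p p) ρ ∩ range I := by
    rintro _ ⟨x, hx, rfl⟩
    exact ⟨hx.2, mem_range_self _⟩
  obtain ⟨K, hK⟩ := exists_eventually_euclideanHausdorffMeasure_ball_le hV
    (inter_subset_left.trans hUs) (hA.mono hVρ) (hB.mono inter_subset_left)
  obtain ⟨L, hL⟩ := exists_eventually_le_euclideanHausdorffMeasure_ball I.convex_range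
    I.nonempty_interior (mem_extChartAt_source p) (mem_range_self _) hρ hρt hA₀ hA hU hB
  exact isTheta_measureReal_ball_of_eventually_le hK hL

end Volume

section Density

open Asymptotics

theorem isTheta_measureReal_ball_of_density {X : Type*} [MetricSpace X] [MeasurableSpace X]
    {μ m : Measure X} [IsFiniteMeasure μ] {p : X} (hlower : 0 < lowerDensity μ m p)
    (hupper : upperDensity μ m p < ∞) :
    (fun r => μ.real (Metric.ball p r)) =Θ[𝓝[>] 0] fun r => m.real (Metric.ball p r) := by
  obtain ⟨c, hc₀, hc⟩ := exists_between hlower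
  obtain ⟨C, hC, hC_top⟩ := exists_between hupper
  have hbounds : ∀ᶠ r : ℝ in 𝓝[>] 0, c * m (Metric.ball p r) ≤ μ (Metric.ball p r) ∧
      μ (Metric.ball p r) ≤ C * m (Metric.ball p r) := by
    filter_upwards [eventually_lt_of_lt_liminf hc, eventually_lt_of_limsup_lt hC] with r hcr hrC
    exact ⟨ENNReal.mul_le_of_le_div hcr.le, (ENNReal.div_le_iff_le_mul (Or.inr hC_top.ne)
      (Or.inr ((hc₀.trans hcr).trans hrC).ne')).1 hrC.le⟩
  have hm_fin : ∀ᶠ r : ℝ in 𝓝[>] 0, m (Metric.ball p r) ≠ ∞ := by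
    filter_upwards [hbounds] with r hr hm
    rw [hm, ENNReal.mul_top hc₀.ne', top_le_iff] at hr
    exact measure_ne_top _ _ hr.1
  have hc_real : 0 < c.toReal := ENNReal.toReal_pos hc₀.ne' (hc.trans_le le_top).ne
  constructor
  · refine IsBigO.of_bound C.toReal ?_
    filter_upwards [hbounds, hm_fin] with r hr hm
    rw [Real.norm_of_nonneg measureReal_nonneg, Real.norm_of_nonneg measureReal_nonneg,
      measureReal_def, measureReal_def, ← ENNReal.toReal_mul]
    exact ENNReal.toReal_mono (ENNReal.mul_ne_top hC_top.ne hm) hr.2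
  · refine IsBigO.of_bound c.toReal⁻¹ ?_
    filter_upwards [hbounds] with r hr
    rw [Real.norm_of_nonneg measureReal_nonneg, Real.norm_of_nonneg measureReal_nonneg,
      le_inv_mul_iff₀ hc_real, measureReal_def, measureReal_def, ← ENNReal.toReal_mul]
    exact ENNReal.toReal_mono (measure_ne_top _ _) hr.1

/-- The measure `μ` is `d`-regular at `p` with constants `c` and `C`: the measure of a ball of
radius `r ≤ 1` about `p` lies between `c * r ^ d` and `C * r ^ d`. -/
structure IsRegularAt {X : Type*} [MetricSpace X] [MeasurableSpace X] (μ : Measure X) (p : X)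
    (d c C : ℝ) : Prop where
  pos : 0 < c
  le_measureReal_ball : ∀ r, 0 < r → r ≤ 1 → c * r ^ d ≤ μ.real (Metric.ball p r)
  measureReal_ball_le : ∀ r, 0 < r → r ≤ 1 → μ.real (Metric.ball p r) ≤ C * r ^ d

namespace IsRegularAt

variable {X : Type*} [MetricSpace X] [MeasurableSpace X] {μ : Measure X} {p : X} {d c C : ℝ}

theorem upper_pos (h : IsRegularAt μ p d c C) : 0 < C := by
  have hle := (h.le_measureReal_ball 1 one_pos le_rfl).trans
    (h.measureReal_ball_le 1 one_pos le_rfl)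
  rw [Real.one_rpow, mul_one, mul_one] at hle
  exact h.pos.trans_le hle

theorem measure_ball_le [IsFiniteMeasure μ] (h : IsRegularAt μ p d c C) {r : ℝ} (hr₀ : 0 < r)
    (hr₁ : r ≤ 1) : μ (Metric.ball p r) ≤ ENNReal.ofReal (C * r ^ d) := by
  rw [← ofReal_measureReal]
  exact ENNReal.ofReal_le_ofReal (h.measureReal_ball_le r hr₀ hr₁)

theorem exists_of_isTheta [IsFiniteMeasure μ] (hd : 0 ≤ d)
    (hμ : (fun r => μ.real (Metric.ball p r)) =Θ[𝓝[>] 0] fun r => r ^ d) :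
    ∃ c C, IsRegularAt μ p d c C := by
  obtain ⟨A, hA₀, hA⟩ := hμ.1.exists_pos
  obtain ⟨B, hB₀, hB⟩ := hμ.2.exists_pos
  obtain ⟨ε, hε₀, hε⟩ := mem_nhdsGT_iff_exists_Ioc_subset.1 (hA.bound.and hB.bound)
  have hbounds : ∀ r, 0 < r → r ≤ ε →
      μ.real (Metric.ball p r) ≤ A * r ^ d ∧ r ^ d ≤ B * μ.real (Metric.ball p r) := by
    intro r hr₀ hrε
    have := hε ⟨hr₀, hrε⟩
    simpa only [mem_ofPred_eq, Real.norm_of_nonneg measureReal_nonneg,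
      Real.norm_of_nonneg (Real.rpow_nonneg hr₀.le d)] using this
  set e := min ε 1
  have he₀ : 0 < e := lt_min hε₀ one_pos
  refine ⟨B⁻¹ * e ^ d, A + μ.real univ / e ^ d, by positivity, fun r hr₀ hr₁ => ?_,
    fun r hr₀ _ => ?_⟩
  · have her : e * r ≤ ε := (mul_le_of_le_one_right he₀.le hr₁).trans (min_le_left _ _)
    rw [mul_assoc, ← Real.mul_rpow he₀.le hr₀.le, inv_mul_le_iff₀ hB₀]
    refine (hbounds _ (by positivity) her).2.trans (mul_le_mul_of_nonneg_left ?_ hB₀.le)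
    exact measureReal_mono
      (Metric.ball_subset_ball (mul_le_of_le_one_left hr₀.le (min_le_right _ _)))
  · rw [add_mul, div_mul_eq_mul_div, mul_div_assoc, ← Real.div_rpow hr₀.le he₀.le]
    rcases le_total r e with hre | hre
    · exact (hbounds r hr₀ (hre.trans (min_le_left _ _))).1.trans
        (le_add_of_nonneg_right (by positivity))
    · have : 1 ≤ (r / e) ^ d := Real.one_le_rpow ((one_le_div he₀).2 hre) hd
      exact (measureReal_mono (subset_univ _)).trans
        ((le_mul_of_one_le_right measureReal_nonneg this).trans
          (le_add_of_nonneg_left (by positivity)))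

end IsRegularAt

end Density

section Maximal

/-- The running maximum `max_{0 ≤ n ≤ N} ∑_{j<n} g ∘ T^j` of the Birkhoff sums of `g`, defined
through the recursion on which the maximal ergodic theorem rests. -/
def birkhoffMax {X : Type*} (T : X → X) (g : X → ℝ) : ℕ → X → ℝ
  | 0, _ => 0
  | N + 1, x => max 0 (g x + birkhoffMax T g N (T x))

variable {X : Type*} {T : X → X} {f g : X → ℝ}

theorem birkhoffMax_nonneg (N : ℕ) (x : X) : 0 ≤ birkhoffMax T g N x := by
  cases N with
  | zero => exact le_rfl
  | succ N => exact le_max_left _ _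

theorem birkhoffMax_le_succ (N : ℕ) (x : X) :
    birkhoffMax T g N x ≤ birkhoffMax T g (N + 1) x := by
  induction N generalizing x with
  | zero => exact birkhoffMax_nonneg 1 x
  | succ N ih => exact max_le_max_left 0 (add_le_add_right (ih (T x)) _)

theorem birkhoffSum_le_birkhoffMax (N : ℕ) (x : X) :
    birkhoffSum T g N x ≤ birkhoffMax T g N x := by
  induction N generalizing x with
  | zero => exact (birkhoffSum_zero T g x).le
  | succ N ih =>
    rw [birkhoffSum_succ']
    exact (add_le_add_right (ih (T x)) _).trans (le_max_right _ _)

theorem birkhoffMax_sub_comp_le {N : ℕ} {x : X} (hx : 0 < birkhoffMax T g N x) :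
    birkhoffMax T g N x - birkhoffMax T g N (T x) ≤ g x := by
  cases N with
  | zero => exact absurd hx (lt_irrefl 0)
  | succ N =>
    have hmax : birkhoffMax T g (N + 1) x = g x + birkhoffMax T g N (T x) :=
      max_eq_right (le_of_lt ((lt_max_iff.1 hx).resolve_left (lt_irrefl 0)))
    rw [hmax, sub_le_iff_le_add]
    exact add_le_add_right (birkhoffMax_le_succ N (T x)) _

variable [MeasurableSpace X] {μ : Measure X}

theorem integrable_birkhoffMax (hT : MeasurePreserving T μ μ) (hg : Integrable g μ) (N : ℕ) :
    Integrable (birkhoffMax T g N) μ := by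
  induction N with
  | zero => exact integrable_zero X ℝ μ
  | succ N ih => exact (integrable_zero X ℝ μ).sup (hg.add (hT.integrable_comp_of_integrable ih))

theorem setIntegral_birkhoffMax_pos_nonneg (hT : MeasurePreserving T μ μ) (hg : Integrable g μ)
    (N : ℕ) : 0 ≤ ∫ x in {x | 0 < birkhoffMax T g N x}, g x ∂μ := by
  set M := birkhoffMax T g N
  set P := {x | 0 < M x}
  have hM : Integrable M μ := integrable_birkhoffMax hT hg N
  have hMT : Integrable (fun x => M (T x)) μ := hT.integrable_comp_of_integrable hM
  have hP : NullMeasurableSet P μ := nullMeasurableSet_lt aemeasurable_const hM.aemeasurable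
  have hsupport : ∫ x in P, M x ∂μ = ∫ x, M x ∂μ :=
    setIntegral_eq_integral_of_forall_compl_eq_zero fun x hx =>
      le_antisymm (not_lt.1 hx) (birkhoffMax_nonneg N x)
  have hshift : ∫ x in P, M (T x) ∂μ ≤ ∫ x, M x ∂μ := by
    have hinv := integral_map (f := M) hT.aemeasurable (hT.map_eq.symm ▸ hM.aestronglyMeasurable)
    rw [hT.map_eq] at hinv
    rw [hinv]
    exact setIntegral_le_integral hMT (Eventually.of_forall fun x => birkhoffMax_nonneg N (T x))
  calc (0 : ℝ) ≤ ∫ x in P, M x ∂μ - ∫ x in P, M (T x) ∂μ := by linarith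
    _ = ∫ x in P, (M x - M (T x)) ∂μ := (integral_sub hM.integrableOn hMT.integrableOn).symm
    _ ≤ ∫ x in P, g x ∂μ :=
      setIntegral_mono_on₀ (hM.sub hMT).integrableOn hg.integrableOn hP
        fun x hx => birkhoffMax_sub_comp_le hx

variable [IsFiniteMeasure μ]

theorem measure_exists_lt_birkhoffSum_le (hT : MeasurePreserving T μ μ) (hf : Integrable f μ)
    (hf₀ : 0 ≤ᵐ[μ] f) {L : ℝ} (hL : 0 < L) :
    μ {x | ∃ n : ℕ, L * n < birkhoffSum T f n x} ≤ ENNReal.ofReal ((∫ x, f x ∂μ) / L) := by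
  set g : X → ℝ := fun x => f x - L
  have hg : Integrable g μ := hf.sub (integrable_const L)
  have hsubset : {x | ∃ n : ℕ, L * n < birkhoffSum T f n x} ⊆
      ⋃ N, {x | 0 < birkhoffMax T g N x} := by
    rintro x ⟨n, hn⟩
    refine mem_iUnion.2 ⟨n, lt_of_lt_of_le ?_ (birkhoffSum_le_birkhoffMax n x)⟩
    simpa [g, birkhoffSum, mul_comm] using hn
  have hmono : Monotone fun N => {x | 0 < birkhoffMax T g N x} :=
    monotone_nat_of_le_succ fun N x hx => lt_of_lt_of_le hx (birkhoffMax_le_succ N x)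
  refine (measure_mono hsubset).trans ?_
  rw [hmono.measure_iUnion]
  refine iSup_le fun N => ?_
  set P := {x | 0 < birkhoffMax T g N x}
  have hsplit : ∫ x in P, g x ∂μ = ∫ x in P, f x ∂μ - μ.real P * L := by
    rw [integral_sub hf.integrableOn (integrable_const L).integrableOn, setIntegral_const,
      smul_eq_mul]
  have hmain : μ.real P * L ≤ ∫ x, f x ∂μ := by
    linarith [setIntegral_birkhoffMax_pos_nonneg hT hg N, setIntegral_le_integral (s := P) hf hf₀]
  rw [← ofReal_measureReal]
  exact ENNReal.ofReal_le_ofReal ((le_div_iff₀ hL).2 hmain)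

theorem ae_exists_birkhoffSum_le (hT : MeasurePreserving T μ μ) (hf : Integrable f μ)
    (hf₀ : 0 ≤ᵐ[μ] f) : ∀ᵐ x ∂μ, ∃ K : ℝ, ∀ n : ℕ, birkhoffSum T f n x ≤ K * n := by
  have hnull : μ {x | ∀ m : ℕ, ∃ n : ℕ, ((m : ℝ) + 1) * n < birkhoffSum T f n x} = 0 := by
    have hlim : Tendsto (fun m : ℕ => ENNReal.ofReal ((∫ x, f x ∂μ) / ((m : ℝ) + 1))) atTop
        (𝓝 0) := by
      rw [← ENNReal.ofReal_zero]
      exact ENNReal.tendsto_ofReal (tendsto_const_nhds.div_atTop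
        (tendsto_atTop_add_const_right _ _ tendsto_natCast_atTop_atTop))
    refine le_antisymm (ge_of_tendsto' hlim fun m => ?_) bot_le
    refine (measure_mono ?_).trans
      (measure_exists_lt_birkhoffSum_le hT hf hf₀ (L := (m : ℝ) + 1) (by positivity))
    exact fun x hx => hx m
  filter_upwards [measure_eq_zero_iff_ae_notMem.1 hnull] with x hx
  simp only [not_forall, not_exists, not_lt] at hx
  obtain ⟨m, hm⟩ := hx
  exact ⟨m + 1, hm⟩

end Maximal

section LogGauge

open Asymptotics

/-- The gauge `y ^ s / (log (e + y)) ^ q`. For `0 < s ≤ 1` it is subadditive and so turns a sum of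
non-integrable terms into a sum of integrable ones; the shift by `e` keeps the logarithm at least
`1` for `y ≥ 0`. -/
def logGauge (s q y : ℝ) : ℝ :=
  y ^ s / Real.log (Real.exp 1 + y) ^ q

variable {s q y z : ℝ}

theorem one_le_log_exp_one_add (hy : 0 ≤ y) : 1 ≤ Real.log (Real.exp 1 + y) := by
  rw [Real.le_log_iff_exp_le (by positivity)]
  exact le_add_of_nonneg_right hy

theorem log_exp_one_add_rpow_pos (q : ℝ) (hy : 0 ≤ y) : 0 < Real.log (Real.exp 1 + y) ^ q :=
  Real.rpow_pos_of_pos (one_pos.trans_le (one_le_log_exp_one_add hy)) q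

theorem logGauge_nonneg (hy : 0 ≤ y) : 0 ≤ logGauge s q y :=
  div_nonneg (Real.rpow_nonneg hy s) (log_exp_one_add_rpow_pos q hy).le

theorem logGauge_zero (hs : s ≠ 0) : logGauge s q 0 = 0 := by
  rw [logGauge, Real.zero_rpow hs, zero_div]

theorem logGauge_le_rpow (hq : 0 ≤ q) (hy : 0 ≤ y) : logGauge s q y ≤ y ^ s :=
  div_le_self (Real.rpow_nonneg hy s) (Real.one_le_rpow (one_le_log_exp_one_add hy) hq)

theorem mul_logGauge_le_mul_logGauge (hs₀ : s ≠ 0) (hs₁ : s ≤ 1) (hq : 0 ≤ q) (hy : 0 ≤ y)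
    (hyz : y ≤ z) : y * logGauge s q z ≤ z * logGauge s q y := by
  rcases hy.eq_or_lt with rfl | hy₀
  · rw [zero_mul, logGauge_zero hs₀, mul_zero]
  have hz₀ : 0 < z := hy₀.trans_le hyz
  have hpow : y * z ^ s ≤ z * y ^ s := by
    have := Real.rpow_le_rpow_of_nonpos hy₀ hyz (sub_nonpos.2 hs₁)
    rwa [Real.rpow_sub_one hy₀.ne', Real.rpow_sub_one hz₀.ne', div_le_div_iff₀ hz₀ hy₀,
      mul_comm, mul_comm (y ^ s)] at this
  have hlog : Real.log (Real.exp 1 + y) ^ q ≤ Real.log (Real.exp 1 + z) ^ q := by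
    have := one_le_log_exp_one_add hy
    gcongr
  rw [logGauge, logGauge, ← mul_div_assoc, ← mul_div_assoc]
  exact div_le_div₀ (by positivity) hpow (log_exp_one_add_rpow_pos q hy) hlog

theorem logGauge_sum_le {ι : Type*} (t : Finset ι) {f : ι → ℝ} (hf : ∀ i, 0 ≤ f i) (hs₀ : s ≠ 0)
    (hs₁ : s ≤ 1) (hq : 0 ≤ q) : logGauge s q (∑ i ∈ t, f i) ≤ ∑ i ∈ t, logGauge s q (f i) := by
  rcases (Finset.sum_nonneg fun i (_ : i ∈ t) => hf i).eq_or_lt with hzero | hpos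
  · rw [← hzero, logGauge_zero hs₀]
    exact Finset.sum_nonneg fun i _ => logGauge_nonneg (hf i)
  refine le_of_mul_le_mul_left ?_ hpos
  rw [Finset.sum_mul, Finset.mul_sum]
  exact Finset.sum_le_sum fun i hi => mul_logGauge_le_mul_logGauge hs₀ hs₁ hq (hf i)
    (Finset.single_le_sum (fun j _ => hf j) hi)

theorem isLittleO_rpow_rpow_atTop_of_lt {a b : ℝ} (hab : a < b) :
    (fun t : ℝ => t ^ a) =o[atTop] fun t : ℝ => t ^ b := by
  have hratio : Tendsto (fun t : ℝ => t ^ a / t ^ b) atTop (𝓝 0) := by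
    refine (tendsto_rpow_neg_atTop (sub_pos.2 hab)).congr' ?_
    filter_upwards [eventually_gt_atTop 0] with t ht
    rw [neg_sub, Real.rpow_sub ht]
  refine (isLittleO_iff_tendsto' ?_).2 hratio
  filter_upwards [eventually_gt_atTop 0] with t ht hzero
  exact absurd hzero (by positivity)

theorem eventually_rpow_half_le_logGauge (hs : 0 < s) (q : ℝ) :
    ∀ᶠ y in atTop, y ^ (s / 2) ≤ logGauge s q y := by
  have hshift : Tendsto (fun y : ℝ => Real.exp 1 + y) atTop atTop :=
    tendsto_atTop_add_const_left _ _ tendsto_id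
  have hlittle := (isLittleO_log_rpow_rpow_atTop q (half_pos hs)).comp_tendsto hshift
  have hc : (0 : ℝ) < (2 ^ (s / 2))⁻¹ := by positivity
  filter_upwards [hlittle.bound hc, eventually_ge_atTop (Real.exp 1)] with y hy hexp
  have hy₀ : 0 < y := (Real.exp_pos 1).trans_le hexp
  have hlog := log_exp_one_add_rpow_pos q hy₀.le
  rw [Function.comp_apply, Function.comp_apply, Real.norm_of_nonneg hlog.le,
    Real.norm_of_nonneg (by positivity), le_inv_mul_iff₀ (by positivity)] at hy
  have hdouble : (Real.exp 1 + y) ^ (s / 2) ≤ 2 ^ (s / 2) * y ^ (s / 2) := by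
    rw [← Real.mul_rpow two_pos.le hy₀.le]
    exact Real.rpow_le_rpow (by positivity) (by linarith) (half_pos hs).le
  rw [logGauge, le_div_iff₀ hlog]
  calc y ^ (s / 2) * Real.log (Real.exp 1 + y) ^ q ≤ y ^ (s / 2) * y ^ (s / 2) :=
        mul_le_mul_of_nonneg_left (le_of_mul_le_mul_left (hy.trans hdouble) (by positivity))
          (by positivity)
    _ = y ^ s := by rw [← Real.rpow_add hy₀, add_halves]

theorem eventually_log_le_of_logGauge_le (hs : 0 < s) (q : ℝ) {K : ℝ} (hK : 0 ≤ K) :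
    ∀ᶠ t : ℝ in atTop, ∀ y, 0 ≤ y → logGauge s q y ≤ K * t →
      Real.log (Real.exp 1 + y) ≤ (2 / s + 1) * Real.log t := by
  obtain ⟨A, hA⟩ := eventually_atTop.1 (eventually_rpow_half_le_logGauge hs q)
  filter_upwards [eventually_ge_atTop 1,
    eventually_ge_atTop (Real.exp 1 + (max A 0 + K ^ (2 / s)))] with t ht₁ ht y hy hyt
  have ht₀ : 0 < t := one_pos.trans_le ht₁
  have hy_le : y ≤ max A 0 + K ^ (2 / s) * t ^ (2 / s) := by
    rcases le_total y A with hyA | hAy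
    · exact (hyA.trans (le_max_left _ _)).trans (le_add_of_nonneg_right (by positivity))
    · have hpow := Real.rpow_le_rpow (by positivity) ((hA y hAy).trans hyt)
        (by positivity : 0 ≤ 2 / s)
      rw [← Real.rpow_mul hy, div_mul_div_cancel₀ two_ne_zero, div_self hs.ne', Real.rpow_one,
        Real.mul_rpow hK ht₀.le] at hpow
      exact hpow.trans (le_add_of_nonneg_left (le_max_right _ _))
  have hpow₁ : 1 ≤ t ^ (2 / s) := Real.one_le_rpow ht₁ (by positivity)
  rw [← Real.log_rpow ht₀]
  refine Real.log_le_log (by positivity) ?_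
  calc Real.exp 1 + y ≤ Real.exp 1 * t ^ (2 / s) + (max A 0 * t ^ (2 / s) +
        K ^ (2 / s) * t ^ (2 / s)) :=
        add_le_add (le_mul_of_one_le_right (by positivity) hpow₁) (hy_le.trans
          (add_le_add_left (le_mul_of_one_le_right (le_max_right _ _) hpow₁) _))
    _ = (Real.exp 1 + (max A 0 + K ^ (2 / s))) * t ^ (2 / s) := by ring
    _ ≤ t * t ^ (2 / s) := by gcongr
    _ = t ^ (2 / s + 1) := by rw [Real.rpow_add_one ht₀.ne', mul_comm]

theorem eventually_le_of_logGauge_le (hs : 0 < s) (hq : 0 ≤ q) {K : ℝ} (hK : 0 ≤ K) :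
    ∃ C : ℝ, ∀ᶠ t : ℝ in atTop, ∀ y, 0 ≤ y → logGauge s q y ≤ K * t →
      y ≤ C * (t ^ s⁻¹ * Real.log t ^ (q / s)) := by
  refine ⟨(K * (2 / s + 1) ^ q) ^ s⁻¹, ?_⟩
  filter_upwards [eventually_log_le_of_logGauge_le hs q hK, eventually_ge_atTop 1]
    with t hlog ht y hy hyt
  have ht₀ : 0 < t := one_pos.trans_le ht
  have hlogt : 0 ≤ Real.log t := Real.log_nonneg ht
  have hpow : y ^ s ≤ K * (2 / s + 1) ^ q * (t * Real.log t ^ q) :=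
    calc y ^ s ≤ K * t * Real.log (Real.exp 1 + y) ^ q :=
          (div_le_iff₀ (log_exp_one_add_rpow_pos q hy)).1 hyt
      _ ≤ K * t * ((2 / s + 1) * Real.log t) ^ q := by
          have := one_le_log_exp_one_add hy
          gcongr
          exact hlog y hy hyt
      _ = K * (2 / s + 1) ^ q * (t * Real.log t ^ q) := by
          rw [Real.mul_rpow (by positivity) hlogt]
          ring
  calc y = (y ^ s) ^ s⁻¹ := (Real.rpow_rpow_inv hy hs.ne').symm
    _ ≤ (K * (2 / s + 1) ^ q * (t * Real.log t ^ q)) ^ s⁻¹ := by gcongr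
    _ = (K * (2 / s + 1) ^ q) ^ s⁻¹ * (t ^ s⁻¹ * Real.log t ^ (q / s)) := by
        rw [Real.mul_rpow (by positivity) (by positivity),
          Real.mul_rpow ht₀.le (by positivity), ← Real.rpow_mul hlogt, ← div_eq_mul_inv]

theorem ae_birkhoffSum_isBigO_of_integrable_logGauge {X : Type*} [MeasurableSpace X] {T : X → X}
    {μ : Measure X} [IsFiniteMeasure μ] (hT : MeasurePreserving T μ μ) {f : X → ℝ}
    (hf₀ : ∀ x, 0 ≤ f x) (hs₀ : 0 < s) (hs₁ : s ≤ 1) (hq : 0 ≤ q)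
    (hf : Integrable (fun x => logGauge s q (f x)) μ) :
    ∀ᵐ x ∂μ, (fun n => birkhoffSum T f n x) =O[atTop]
      fun n : ℕ => (n : ℝ) ^ s⁻¹ * Real.log n ^ (q / s) := by
  filter_upwards [ae_exists_birkhoffSum_le hT hf (Eventually.of_forall fun x =>
    logGauge_nonneg (hf₀ x))] with x hx
  obtain ⟨K, hK⟩ := hx
  obtain ⟨C, hC⟩ := eventually_le_of_logGauge_le hs₀ hq (le_max_right K 0)
  refine IsBigO.of_bound C ?_
  filter_upwards [tendsto_natCast_atTop_atTop.eventually hC, eventually_ge_atTop 1] with n hn hn₁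
  have hsum : 0 ≤ birkhoffSum T f n x := Finset.sum_nonneg fun j _ => hf₀ _
  have : 0 ≤ Real.log n := Real.log_nonneg (Nat.one_le_cast.2 hn₁)
  rw [Real.norm_of_nonneg hsum, Real.norm_of_nonneg (by positivity)]
  refine hn _ hsum ((logGauge_sum_le _ (fun j => hf₀ _) hs₀.ne' hs₁ hq).trans ((hK n).trans ?_))
  gcongr
  exact le_max_left K 0

end LogGauge

section UpperBound

open Asymptotics

theorem log_div_mul_le_log_exp_one_add_pow {a : ℝ} (ha : 1 < a) (i : ℕ) :
    Real.log a / (1 + Real.log a) * ((i : ℝ) + 1) ≤ Real.log (Real.exp 1 + a ^ i) := by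
  have hL : 0 < Real.log a := Real.log_pos ha
  have hone : 1 ≤ Real.log (Real.exp 1 + a ^ i) := one_le_log_exp_one_add (by positivity)
  have hpow : i * Real.log a ≤ Real.log (Real.exp 1 + a ^ i) := by
    rw [← Real.log_pow]
    exact Real.log_le_log (by positivity) (le_add_of_nonneg_left (Real.exp_pos 1).le)
  rw [div_mul_eq_mul_div, div_le_iff₀ (by positivity)]
  linarith [mul_le_mul_of_nonneg_left hone hL.le]

variable {d k c C q : ℝ}

theorem rpow_neg_rpow_div {r : ℝ} (hr : 0 ≤ r) (hk : k ≠ 0) :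
    (r ^ (-k)) ^ (d / k) = r⁻¹ ^ d := by
  rw [← Real.rpow_mul hr, neg_mul, mul_div_cancel₀ _ hk, Real.rpow_neg hr, Real.inv_rpow hr]

theorem logGauge_rpow_neg_le (hd : 0 ≤ d) (hk : 0 < k) (hq : 0 ≤ q) {r u v : ℝ} (hr : 0 ≤ r)
    (hu : 0 ≤ u) (hur : u ≤ r⁻¹) (hrv : r⁻¹ ≤ v) :
    logGauge (d / k) q (r ^ (-k)) ≤ v ^ d / Real.log (Real.exp 1 + u ^ k) ^ q := by
  have hlog := one_le_log_exp_one_add (Real.rpow_nonneg hu k)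
  have hv : 0 ≤ v := (inv_nonneg.2 hr).trans hrv
  have hinv : r ^ (-k) = r⁻¹ ^ k := by rw [Real.rpow_neg hr, Real.inv_rpow hr]
  rw [logGauge, rpow_neg_rpow_div hr hk.ne', hinv]
  gcongr

variable {X : Type*} [MetricSpace X] {p : X}

theorem S_eq_ofReal_birkhoffSum {T : X → X} {x : X} (hx : ∀ j, T^[j] x ≠ p) (n : ℕ) :
    S T p k n x = ENNReal.ofReal (birkhoffSum T (fun y => dist y p ^ (-k)) n x) := by
  rw [birkhoffSum, ENNReal.ofReal_sum_of_nonneg fun j _ => Real.rpow_nonneg dist_nonneg _]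
  refine Finset.sum_congr rfl fun j _ => ?_
  rw [obs, edist_dist, ENNReal.ofReal_rpow_of_pos (dist_pos.2 (hx j))]

variable [MeasurableSpace X] {μ : Measure X}

theorem IsRegularAt.measure_singleton [IsFiniteMeasure μ] (h : IsRegularAt μ p d c C)
    (hd : 0 < d) : μ {p} = 0 := by
  have hlim : Tendsto (fun r : ℝ => ENNReal.ofReal (C * r ^ d)) (𝓝[>] 0) (𝓝 0) := by
    have hcont : Continuous fun r : ℝ => ENNReal.ofReal (C * r ^ d) :=
      ENNReal.continuous_ofReal.comp ((Real.continuous_rpow_const hd.le).const_mul C)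
    simpa [Real.zero_rpow hd.ne'] using (hcont.tendsto 0).mono_left nhdsWithin_le_nhds
  refine le_antisymm (ge_of_tendsto hlim ?_) zero_le
  filter_upwards [Ioc_mem_nhdsGT (zero_lt_one (α := ℝ))] with r hr
  exact (measure_mono (singleton_subset_iff.2 (Metric.mem_ball_self hr.1))).trans
    (h.measure_ball_le hr.1 hr.2)

theorem IsRegularAt.logGauge_mul_measureReal_ball_le (h : IsRegularAt μ p d c C) (hk : 0 < k)
    (hq : 0 ≤ q) (i : ℕ) :
    (4 * (2 : ℝ) ^ i) ^ d / Real.log (Real.exp 1 + ((2 : ℝ) ^ i) ^ k) ^ q *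
        μ.real (Metric.ball p ((2 : ℝ)⁻¹ ^ i)) ≤
      C * 4 ^ d / (Real.log (2 ^ k) / (1 + Real.log (2 ^ k))) ^ q *
        (1 / ((i + 1 : ℕ) : ℝ) ^ q) := by
  set θ := Real.log (2 ^ k) / (1 + Real.log (2 ^ k))
  have hbase : (1 : ℝ) < 2 ^ k := Real.one_lt_rpow one_lt_two hk
  have hθ : 0 < θ := by
    have := Real.log_pos hbase
    positivity
  have hC := h.upper_pos
  have hlog : θ * ((i : ℝ) + 1) ≤ Real.log (Real.exp 1 + ((2 : ℝ) ^ i) ^ k) := by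
    rw [← Real.rpow_pow_comm two_pos.le]
    exact log_div_mul_le_log_exp_one_add_pow hbase i
  have hball := h.measureReal_ball_le ((2 : ℝ)⁻¹ ^ i) (by positivity)
    (pow_le_one₀ (by norm_num) (by norm_num))
  calc _ ≤ (4 * (2 : ℝ) ^ i) ^ d / (θ * ((i : ℝ) + 1)) ^ q * (C * ((2 : ℝ)⁻¹ ^ i) ^ d) := by
        gcongr
    _ = C * 4 ^ d / θ ^ q * (1 / ((i + 1 : ℕ) : ℝ) ^ q) := by
        rw [Real.mul_rpow (by positivity) (by positivity),
          Real.mul_rpow hθ.le (by positivity), inv_pow, Real.inv_rpow (by positivity)]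
        push_cast
        field_simp

variable [BorelSpace X]

theorem lintegral_le_add_tsum_mul_measure_ball {f : X → ℝ≥0∞} {A : ℝ≥0∞} {b : ℕ → ℝ≥0∞}
    (hp : f p = 0) (hA : ∀ x, 2⁻¹ < dist x p → f x ≤ A)
    (hb : ∀ i x, (2 : ℝ)⁻¹ ^ (i + 2) < dist x p → dist x p < (2 : ℝ)⁻¹ ^ i → f x ≤ b i) :
    ∫⁻ x, f x ∂μ ≤ A * μ univ + ∑' i, b i * μ (Metric.ball p ((2 : ℝ)⁻¹ ^ i)) := by
  set B : ℕ → Set X := fun i => Metric.ball p ((2 : ℝ)⁻¹ ^ i)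
  have hB : ∀ i, MeasurableSet (B i) := fun i => Metric.isOpen_ball.measurableSet
  have hpointwise : ∀ x, f x ≤ A + ∑' i, (B i).indicator (fun _ => b i) x := by
    intro x
    rcases (dist_nonneg (x := x) (y := p)).eq_or_lt with hzero | hpos
    · rw [dist_eq_zero.1 hzero.symm, hp]
      exact zero_le
    rcases lt_or_ge 2⁻¹ (dist x p) with hfar | hnear
    · exact (hA x hfar).trans le_self_add
    obtain ⟨i, hi₁, hi₂⟩ := exists_nat_pow_near_of_lt_one (x := 2 * dist x p) (by positivity)
      (by linarith) (by norm_num : (0 : ℝ) < 2⁻¹) (by norm_num)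
    have hball : x ∈ B i := Metric.mem_ball.2 (by linarith)
    calc f x ≤ (B i).indicator (fun _ => b i) x := by
          rw [indicator_of_mem hball]
          refine hb i x ?_ hball
          rw [pow_succ]
          linarith
      _ ≤ ∑' i, (B i).indicator (fun _ => b i) x := ENNReal.le_tsum i
      _ ≤ _ := le_add_self
  refine (lintegral_mono hpointwise).trans_eq ?_
  rw [lintegral_add_left measurable_const, lintegral_const,
    lintegral_tsum fun i => (measurable_const.indicator (hB i)).aemeasurable]
  simp only [lintegral_indicator_const (hB _), B]

theorem measurable_logGauge_dist_rpow (p : X) (s q k : ℝ) :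
    Measurable fun x : X => logGauge s q (dist x p ^ (-k)) := by
  have hpow : Measurable fun x : X => dist x p ^ (-k) :=
    (continuous_id.dist continuous_const).measurable.pow_const _
  exact (hpow.pow_const _).div ((hpow.const_add _).log.pow_const _)

theorem IsRegularAt.integrable_logGauge_dist_rpow [IsFiniteMeasure μ]
    (h : IsRegularAt μ p d c C) (hd : 0 < d) (hk : 0 < k) (hq : 1 < q) :
    Integrable (fun x => logGauge (d / k) q (dist x p ^ (-k))) μ := by
  have hq₀ : 0 ≤ q := by linarith
  have hnonneg : ∀ x : X, 0 ≤ dist x p ^ (-k) := fun x => Real.rpow_nonneg dist_nonneg _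
  set b : ℕ → ℝ := fun i =>
    (4 * (2 : ℝ) ^ i) ^ d / Real.log (Real.exp 1 + ((2 : ℝ) ^ i) ^ k) ^ q
  have hb : ∀ i, 0 ≤ b i := fun i =>
    div_nonneg (by positivity) (log_exp_one_add_rpow_pos q (by positivity)).le
  refine ⟨(measurable_logGauge_dist_rpow p _ q k).aestronglyMeasurable, ?_⟩
  rw [hasFiniteIntegral_iff_ofReal (Eventually.of_forall fun x => logGauge_nonneg (hnonneg x))]
  refine (lintegral_le_add_tsum_mul_measure_ball (p := p) (A := ENNReal.ofReal (2 ^ d))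
    (b := fun i => ENNReal.ofReal (b i)) ?_ (fun x hx => ?_) fun i x hx₁ hx₂ => ?_).trans_lt ?_
  · rw [dist_self, Real.zero_rpow (neg_ne_zero.2 hk.ne'), logGauge_zero (by positivity),
      ENNReal.ofReal_zero]
  · refine ENNReal.ofReal_le_ofReal ((logGauge_le_rpow hq₀ (hnonneg x)).trans ?_)
    rw [rpow_neg_rpow_div dist_nonneg hk.ne']
    exact Real.rpow_le_rpow (by positivity) (inv_le_of_inv_le₀ two_pos hx.le) hd.le
  · have hdist : 0 < dist x p := lt_trans (by positivity) hx₁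
    refine ENNReal.ofReal_le_ofReal (logGauge_rpow_neg_le hd.le hk hq₀ dist_nonneg
      (by positivity) ?_ ?_)
    · exact (le_inv_comm₀ (by positivity) hdist).2 (inv_pow (2 : ℝ) i ▸ hx₂.le)
    · refine inv_le_of_inv_le₀ (by positivity) (le_of_eq_of_le ?_ hx₁.le)
      rw [pow_add, mul_inv, inv_pow]
      norm_num [mul_comm]
  · have hsum := (((summable_nat_add_iff 1).2 (Real.summable_one_div_nat_rpow.2 hq)).mul_left
      (C * 4 ^ d / (Real.log (2 ^ k) / (1 + Real.log (2 ^ k))) ^ q)).tsum_ofReal_lt_top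
    refine ENNReal.add_lt_top.2 ⟨by finiteness, lt_of_le_of_lt (ENNReal.tsum_le_tsum fun i => ?_)
      hsum⟩
    rw [← ofReal_measureReal, ← ENNReal.ofReal_mul (hb i)]
    exact ENNReal.ofReal_le_ofReal (h.logGauge_mul_measureReal_ball_le hk hq₀ i)

theorem limsup_ofReal_div_eq_zero {u v : ℕ → ℝ} (huv : u =o[atTop] v)
    (hv : ∀ᶠ n in atTop, 0 < v n) :
    limsup (fun n => ENNReal.ofReal (u n) / ENNReal.ofReal (v n)) atTop = 0 := by
  refine Tendsto.limsup_eq ?_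
  rw [← ENNReal.ofReal_zero]
  refine (ENNReal.tendsto_ofReal huv.tendsto_div_nhds_zero).congr' ?_
  filter_upwards [hv] with n hn
  exact ENNReal.ofReal_div_of_pos hn

theorem IsRegularAt.ae_limsup_S_div_eq_zero [IsFiniteMeasure μ] {T : X → X}
    (h : IsRegularAt μ p d c C) (hd : 0 < d) (hk : d ≤ k) (hT : MeasurePreserving T μ μ)
    {ε : ℝ} (hε : 0 < ε) :
    ∀ᵐ x ∂μ, limsup (fun n : ℕ => S T p k n x /
      ENNReal.ofReal ((n : ℝ) ^ (k / d) * Real.log n ^ (k / d + ε))) atTop = 0 := by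
  have hk₀ : 0 < k := hd.trans_le hk
  set q := 1 + ε * (d / k) / 2
  have hq : 1 < q := lt_add_of_pos_right _ (by positivity)
  have hexp : q / (d / k) < k / d + ε := by
    have : q / (d / k) = k / d + ε / 2 := by
      simp only [q]
      field_simp
    linarith
  have hlog : Tendsto (fun n : ℕ => Real.log n) atTop atTop :=
    Real.tendsto_log_atTop.comp tendsto_natCast_atTop_atTop
  have havoid : ∀ᵐ x ∂μ, ∀ j, T^[j] x ≠ p := ae_all_iff.2 fun j =>
    (hT.iterate j).quasiMeasurePreserving.ae
      (measure_eq_zero_iff_ae_notMem.1 (h.measure_singleton hd))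
  filter_upwards [havoid, ae_birkhoffSum_isBigO_of_integrable_logGauge hT
    (fun x => Real.rpow_nonneg dist_nonneg (-k)) (by positivity) ((div_le_one hk₀).2 hk)
    (by linarith) (h.integrable_logGauge_dist_rpow hd hk₀ hq)] with x hxp hx
  simp only [S_eq_ofReal_birkhoffSum hxp]
  refine limsup_ofReal_div_eq_zero (hx.trans_isLittleO ?_) ?_
  · simp only [inv_div]
    exact (isBigO_refl _ _).mul_isLittleO
      ((isLittleO_rpow_rpow_atTop_of_lt hexp).comp_tendsto hlog)
  · filter_upwards [eventually_gt_atTop 0, hlog.eventually_gt_atTop 0] with n hn hlogn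
    positivity

end UpperBound

section Hits

open Asymptotics

theorem sum_Icc_one_sub_sum_Icc_one (f : ℕ → ℝ) {m n : ℕ} (hmn : m ≤ n) :
    ∑ j ∈ Finset.Icc 1 n, f j - ∑ j ∈ Finset.Icc 1 m, f j = ∑ j ∈ Finset.Ioc m n, f j :=
  sub_eq_of_eq_add' (Finset.sum_Ioc_consecutive f m.zero_le hmn).symm

variable {X : Type*} {T : X → X} {B : ℕ → Set X} {x : X}

theorem hits_sub_hits {m n : ℕ} (hmn : m ≤ n) :
    hits T B n x - hits T B m x =
      ∑ j ∈ Finset.Ioc m n, (B j).indicator (fun _ => (1 : ℝ)) (T^[j] x) :=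
  sum_Icc_one_sub_sum_Icc_one _ hmn

theorem exists_mem_of_hits_lt_hits {m n : ℕ} (hmn : m ≤ n) (h : hits T B m x < hits T B n x) :
    ∃ j ∈ Finset.Ioc m n, T^[j] x ∈ B j := by
  rw [← sub_pos, hits_sub_hits hmn] at h
  obtain ⟨j, hj, hne⟩ := Finset.exists_ne_zero_of_sum_ne_zero h.ne'
  exact ⟨j, hj, mem_of_indicator_ne_zero hne⟩

variable [MeasurableSpace X] {μ : Measure X}

theorem expectedHits_sub_expectedHits {m n : ℕ} (hmn : m ≤ n) :
    expectedHits μ B n - expectedHits μ B m = ∑ j ∈ Finset.Ioc m n, μ.real (B j) :=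
  sum_Icc_one_sub_sum_Icc_one _ hmn

theorem expectedHits_nonneg (n : ℕ) : 0 ≤ expectedHits μ B n :=
  Finset.sum_nonneg fun _ _ => measureReal_nonneg

theorem monotone_expectedHits : Monotone (expectedHits μ B) := fun _ _ h =>
  Finset.sum_le_sum_of_subset_of_nonneg (Finset.Icc_subset_Icc_right h)
    fun _ _ _ => measureReal_nonneg

theorem tendsto_hits_atTop (hE : Tendsto (expectedHits μ B) atTop atTop)
    (hx : (fun n => hits T B n x - expectedHits μ B n) =o[atTop] expectedHits μ B) :
    Tendsto (fun n => hits T B n x) atTop atTop :=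
  IsEquivalent.tendsto_atTop (IsEquivalent.symm hx) hE

section Increments

variable {ι : Type*} {l : Filter ι} {m N : ι → ℕ}

theorem isBigO_comp_of_monotone {w : ℕ → ℝ} (hw : Monotone w) (hw₀ : 0 ≤ w)
    (hmN : ∀ᶠ i in l, m i ≤ N i) : (w ∘ m) =O[l] (w ∘ N) := by
  refine IsBigO.of_bound 1 (hmN.mono fun i hi => ?_)
  rw [one_mul, Function.comp_apply, Function.comp_apply, Real.norm_of_nonneg (hw₀ _),
    Real.norm_of_nonneg (hw₀ _)]
  exact hw hi

theorem isLittleO_comp_sub_comp {u w : ℕ → ℝ} (hw : Monotone w) (hw₀ : 0 ≤ w)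
    (hu : u =o[atTop] w) (hm : Tendsto m l atTop) (hN : Tendsto N l atTop)
    (hmN : ∀ᶠ i in l, m i ≤ N i) : (fun i => u (N i) - u (m i)) =o[l] (w ∘ N) :=
  (hu.comp_tendsto hN).sub ((hu.comp_tendsto hm).trans_isBigO (isBigO_comp_of_monotone hw hw₀ hmN))

theorem isBigO_comp_sub_comp {u w : ℕ → ℝ} (hw : Monotone w) (hw₀ : 0 ≤ w)
    (hu : u =O[atTop] w) (hm : Tendsto m l atTop) (hN : Tendsto N l atTop)
    (hmN : ∀ᶠ i in l, m i ≤ N i) : (fun i => u (N i) - u (m i)) =O[l] (w ∘ N) :=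
  (hu.comp_tendsto hN).sub ((hu.comp_tendsto hm).trans (isBigO_comp_of_monotone hw hw₀ hmN))

theorem eventually_half_le_hits_sub {u : ι → ℝ} (hu : ∀ᶠ i in l, 0 ≤ u i)
    (hle : ∀ᶠ i in l, u i ≤ expectedHits μ B (N i) - expectedHits μ B (m i))
    (h : (fun i => (hits T B (N i) x - expectedHits μ B (N i)) -
      (hits T B (m i) x - expectedHits μ B (m i))) =o[l] u) :
    ∀ᶠ i in l, u i / 2 ≤ hits T B (N i) x - hits T B (m i) x := by
  filter_upwards [hu, hle, h.bound one_half_pos] with i hi₀ hi hbound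
  rw [Real.norm_eq_abs, Real.norm_of_nonneg hi₀] at hbound
  linarith [(abs_le.1 hbound).1]

end Increments

end Hits

section Scales

variable {X : Type*} [MetricSpace X] {T : X → X} {p x : X} {d k : ℝ} {v : ℕ → ℝ}

/-- A sequence of prescribed orders of magnitude for the measures of nested balls. -/
structure IsScale (v : ℕ → ℝ) : Prop where
  pos : ∀ j, 0 < v j
  le_one : ∀ j, v j ≤ 1
  antitone : Antitone v
  tendsto_zero : Tendsto v atTop (𝓝 0)

/-- The ball about `p` whose measure is of order `v j` if the measure is `d`-regular at `p`. -/
def scaleBall (p : X) (d : ℝ) (v : ℕ → ℝ) (j : ℕ) : Set X :=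
  Metric.ball p (v j ^ d⁻¹)

theorem IsScale.nestedBalls (hv : IsScale v) (hd : 0 < d) : NestedBalls p (scaleBall p d v) := by
  refine ⟨fun j => v j ^ d⁻¹, fun j => Real.rpow_pos_of_pos (hv.pos j) _,
    fun i j hij => Real.rpow_le_rpow (hv.pos j).le (hv.antitone hij) (inv_nonneg.2 hd.le), ?_,
    fun j => rfl⟩
  simpa only [Real.zero_rpow (inv_pos.2 hd).ne'] using
    hv.tendsto_zero.rpow_const (p := d⁻¹) (Or.inr (inv_nonneg.2 hd.le))

theorem ofReal_rpow_le_obs (hd : 0 ≤ d) (hk : 0 ≤ k) {v w : ℝ} (hv : 0 < v) (hvw : v ≤ w)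
    (hx : x ∈ Metric.ball p (v ^ d⁻¹)) : ENNReal.ofReal (w ^ (-(k / d))) ≤ obs p k x := by
  have hw : 0 < w := hv.trans_le hvw
  have hdist : edist x p ≤ ENNReal.ofReal (w ^ d⁻¹) := by
    rw [edist_dist]
    exact ENNReal.ofReal_le_ofReal ((Metric.mem_ball.1 hx).le.trans
      (Real.rpow_le_rpow hv.le hvw (inv_nonneg.2 hd)))
  have hexp : w ^ (-(k / d)) = (w ^ d⁻¹) ^ (-k) := by
    rw [← Real.rpow_mul hw.le, div_eq_inv_mul, mul_neg]
  rw [hexp, ← ENNReal.ofReal_rpow_of_pos (Real.rpow_pos_of_pos hw _), obs, ENNReal.rpow_neg,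
    ENNReal.rpow_neg]
  exact ENNReal.inv_le_inv.2 (ENNReal.rpow_le_rpow hdist hk)

theorem obs_iterate_le_S {j n : ℕ} (hjn : j < n) : obs p k (T^[j] x) ≤ S T p k n x :=
  Finset.single_le_sum (f := fun j => obs p k (T^[j] x)) (fun _ _ => zero_le)
    (Finset.mem_range.2 hjn)

theorem IsScale.ofReal_hits_sub_mul_le_S (hv : IsScale v) (hd : 0 ≤ d) (hk : 0 ≤ k) {m n : ℕ}
    (hmn : m ≤ n) (x : X) :
    ENNReal.ofReal ((hits T (scaleBall p d v) n x - hits T (scaleBall p d v) m x) *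
      v m ^ (-(k / d))) ≤ S T p k (n + 1) x := by
  have hvm : 0 ≤ v m ^ (-(k / d)) := Real.rpow_nonneg (hv.pos m).le _
  rw [hits_sub_hits hmn, Finset.sum_mul, ENNReal.ofReal_sum_of_nonneg
    fun j _ => mul_nonneg (indicator_nonneg (fun _ _ => zero_le_one) _) hvm]
  have hsubset : Finset.Ioc m n ⊆ Finset.range (n + 1) := fun j hj =>
    Finset.mem_range_succ_iff.2 (Finset.mem_Ioc.1 hj).2
  refine (Finset.sum_le_sum fun j hj => ?_).trans
    (Finset.sum_le_sum_of_subset (f := fun j => obs p k (T^[j] x)) hsubset)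
  by_cases hx : T^[j] x ∈ scaleBall p d v j
  · rw [indicator_of_mem hx, one_mul]
    exact ofReal_rpow_le_obs hd hk (hv.pos j) (hv.antitone (Finset.mem_Ioc.1 hj).1.le) hx
  · rw [indicator_of_notMem hx, zero_mul, ENNReal.ofReal_zero]
    exact zero_le

variable [MeasurableSpace X] {μ : Measure X} {c C : ℝ}

namespace IsRegularAt

theorem le_measureReal_scaleBall (h : IsRegularAt μ p d c C) (hd : 0 < d) (hv : IsScale v)
    (j : ℕ) : c * v j ≤ μ.real (scaleBall p d v j) := by
  have := h.le_measureReal_ball (v j ^ d⁻¹) (Real.rpow_pos_of_pos (hv.pos j) _)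
    (Real.rpow_le_one (hv.pos j).le (hv.le_one j) (inv_nonneg.2 hd.le))
  rwa [Real.rpow_inv_rpow (hv.pos j).le hd.ne'] at this

theorem measureReal_scaleBall_le (h : IsRegularAt μ p d c C) (hd : 0 < d) (hv : IsScale v)
    (j : ℕ) : μ.real (scaleBall p d v j) ≤ C * v j := by
  have := h.measureReal_ball_le (v j ^ d⁻¹) (Real.rpow_pos_of_pos (hv.pos j) _)
    (Real.rpow_le_one (hv.pos j).le (hv.le_one j) (inv_nonneg.2 hd.le))
  rwa [Real.rpow_inv_rpow (hv.pos j).le hd.ne'] at this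

theorem le_expectedHits_sub (h : IsRegularAt μ p d c C) (hd : 0 < d) (hv : IsScale v) {m n : ℕ}
    (hmn : m ≤ n) : c * ∑ j ∈ Finset.Ioc m n, v j ≤
      expectedHits μ (scaleBall p d v) n - expectedHits μ (scaleBall p d v) m := by
  rw [expectedHits_sub_expectedHits hmn, Finset.mul_sum]
  exact Finset.sum_le_sum fun j _ => h.le_measureReal_scaleBall hd hv j

theorem expectedHits_le (h : IsRegularAt μ p d c C) (hd : 0 < d) (hv : IsScale v) (n : ℕ) :
    expectedHits μ (scaleBall p d v) n ≤ C * ∑ j ∈ Finset.Icc 1 n, v j := by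
  rw [expectedHits, Finset.mul_sum]
  exact Finset.sum_le_sum fun j _ => h.measureReal_scaleBall_le hd hv j

theorem tendsto_expectedHits (h : IsRegularAt μ p d c C) (hd : 0 < d) (hv : IsScale v)
    (hsum : Tendsto (fun n => ∑ j ∈ Finset.Icc 1 n, v j) atTop atTop) :
    Tendsto (expectedHits μ (scaleBall p d v)) atTop atTop := by
  refine tendsto_atTop_mono (fun n => ?_) (hsum.const_mul_atTop h.pos)
  rw [expectedHits, Finset.mul_sum]
  exact Finset.sum_le_sum fun j _ => h.le_measureReal_scaleBall hd hv j

end IsRegularAt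

end Scales

section Sums

theorem sub_le_sum_Ioc {F v : ℕ → ℝ} (h : ∀ j, F (j + 1) - F j ≤ v (j + 1)) {m n : ℕ}
    (hmn : m ≤ n) : F n - F m ≤ ∑ j ∈ Finset.Ioc m n, v j := by
  induction n, hmn using Nat.le_induction with
  | base => rw [sub_self, Finset.Ioc_self, Finset.sum_empty]
  | succ n hmn ih =>
    rw [Finset.sum_Ioc_succ_top hmn]
    linarith [h n]

theorem sum_Ioc_le_sub {F v : ℕ → ℝ} (h : ∀ j, v (j + 1) ≤ F (j + 1) - F j) {m n : ℕ}
    (hmn : m ≤ n) : ∑ j ∈ Finset.Ioc m n, v j ≤ F n - F m := by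
  have := sub_le_sum_Ioc (F := -F) (v := -v) (fun j => by
    simp only [Pi.neg_apply]
    linarith [h j]) hmn
  simp only [Pi.neg_apply, Finset.sum_neg_distrib] at this
  linarith

theorem log_sub_log_le {x y : ℝ} (hx : 0 < x) (hy : 0 < y) :
    Real.log x - Real.log y ≤ (x - y) / y := by
  rw [← Real.log_div hx.ne' hy.ne', sub_div, div_self hy.ne']
  exact Real.log_le_sub_one_of_pos (by positivity)

theorem log_log_sub_log_log_le {x y : ℝ} (hx : 1 < x) (hy : 1 < y) :
    Real.log (Real.log x) - Real.log (Real.log y) ≤ (x - y) / (y * Real.log y) := by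
  have hlogy : 0 < Real.log y := Real.log_pos hy
  calc Real.log (Real.log x) - Real.log (Real.log y)
      ≤ (Real.log x - Real.log y) / Real.log y := log_sub_log_le (Real.log_pos hx) hlogy
    _ ≤ (x - y) / y / Real.log y := by
      gcongr
      exact log_sub_log_le (by linarith) (by linarith)
    _ = (x - y) / (y * Real.log y) := div_div _ _ _

theorem rpow_sub_rpow_le {x y η : ℝ} (hx : 0 < x) (hy : 0 ≤ y) (hη₀ : 0 ≤ η) (hη₁ : η ≤ 1) :
    y ^ η - x ^ η ≤ η * x ^ (η - 1) * (y - x) := by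
  have hbernoulli := rpow_one_add_le_one_add_mul_self (s := y / x - 1)
    (by linarith [div_nonneg hy hx.le]) hη₀ hη₁
  rw [add_sub_cancel, Real.div_rpow hy hx.le, div_le_iff₀ (by positivity)] at hbernoulli
  have hpow : x ^ η = x ^ (η - 1) * x := by
    rw [← Real.rpow_add_one hx.ne', sub_add_cancel]
  have hexpand : (1 + η * (y / x - 1)) * x ^ η = x ^ η + η * x ^ (η - 1) * (y - x) := by
    rw [hpow]
    field_simp
  linarith

theorem log_sub_log_le_sum_inv {m n : ℕ} (hmn : m ≤ n) :
    Real.log (n + 2) - Real.log (m + 2) ≤ ∑ j ∈ Finset.Ioc m n, ((j : ℝ) + 1)⁻¹ := by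
  refine sub_le_sum_Ioc (F := fun n => Real.log (n + 2)) (fun j => ?_) hmn
  push_cast
  refine (log_sub_log_le (by positivity) (by positivity)).trans_eq ?_
  ring

theorem sum_inv_le_log (n : ℕ) : ∑ j ∈ Finset.Icc 1 n, ((j : ℝ) + 1)⁻¹ ≤ Real.log (n + 1) := by
  refine (sum_Ioc_le_sub (F := fun n => Real.log (n + 1)) (fun j => ?_) n.zero_le).trans_eq
    (by simp)
  push_cast
  have := log_sub_log_le (x := (j : ℝ) + 1) (y := j + 1 + 1) (by positivity) (by positivity)
  have hstep : ((j : ℝ) + 1 - (j + 1 + 1)) / (j + 1 + 1) = -((j : ℝ) + 1 + 1)⁻¹ := by ring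
  linarith

theorem log_log_sub_le_sum (n : ℕ) :
    Real.log (Real.log (n + 3)) - Real.log (Real.log 3) ≤
      ∑ j ∈ Finset.Icc 1 n, (((j : ℝ) + 2) * Real.log (j + 2))⁻¹ := by
  refine le_trans (by simp) (sub_le_sum_Ioc (F := fun n => Real.log (Real.log (n + 3)))
    (fun j => ?_) n.zero_le)
  have : (0 : ℝ) ≤ j := j.cast_nonneg
  push_cast
  refine (log_log_sub_log_log_le (by linarith) (by linarith)).trans_eq ?_
  ring_nf

theorem sum_rpow_le {η : ℝ} (hη₀ : 0 < η) (hη₁ : η ≤ 1) (n : ℕ) :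
    ∑ j ∈ Finset.Icc 1 n, ((j : ℝ) + 1) ^ (η - 1) ≤ η⁻¹ * ((n : ℝ) + 1) ^ η := by
  refine (sum_Ioc_le_sub (F := fun n => η⁻¹ * ((n : ℝ) + 1) ^ η) (fun j => ?_)
    n.zero_le).trans (sub_le_self _ (by positivity))
  push_cast
  have := rpow_sub_rpow_le (x := (j : ℝ) + 1 + 1) (y := j + 1) (by positivity) (by positivity)
    hη₀.le hη₁
  rw [← mul_sub, le_inv_mul_iff₀ hη₀]
  linarith

theorem le_sum_Ioc_half_rpow {η : ℝ} (hη : η ≤ 1) {n : ℕ} (hn : 1 ≤ n) :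
    ((n : ℝ) + 1) ^ η / 4 ≤ ∑ j ∈ Finset.Ioc (n / 2) n, ((j : ℝ) + 1) ^ (η - 1) := by
  have hcard : ((n : ℝ) + 1) / 4 ≤ ((n - n / 2 : ℕ) : ℝ) := by
    rw [div_le_iff₀ four_pos]
    exact_mod_cast (by omega : n + 1 ≤ (n - n / 2) * 4)
  have hterm : ∀ j ∈ Finset.Ioc (n / 2) n, ((n : ℝ) + 1) ^ (η - 1) ≤ ((j : ℝ) + 1) ^ (η - 1) := by
    intro j hj
    have hjn : (j : ℝ) ≤ n := Nat.cast_le.2 (Finset.mem_Ioc.1 hj).2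
    exact Real.rpow_le_rpow_of_nonpos (by positivity) (by linarith) (by linarith)
  calc ((n : ℝ) + 1) ^ η / 4 = ((n : ℝ) + 1) / 4 * ((n : ℝ) + 1) ^ (η - 1) := by
        rw [Real.rpow_sub_one (by positivity)]
        field_simp
    _ ≤ ((n - n / 2 : ℕ) : ℝ) * ((n : ℝ) + 1) ^ (η - 1) := by gcongr
    _ ≤ ∑ j ∈ Finset.Ioc (n / 2) n, ((j : ℝ) + 1) ^ (η - 1) := by
      simpa only [Nat.card_Ioc, nsmul_eq_mul] using Finset.card_nsmul_le_sum _ _ _ hterm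

theorem tendsto_natCast_add_atTop (a : ℝ) : Tendsto (fun n : ℕ => (n : ℝ) + a) atTop atTop :=
  tendsto_atTop_add_const_right _ a tendsto_natCast_atTop_atTop

theorem isScale_rpow {a : ℝ} (ha : a < 0) : IsScale fun j => ((j : ℝ) + 1) ^ a where
  pos _ := by positivity
  le_one j := Real.rpow_le_one_of_one_le_of_nonpos (le_add_of_nonneg_left j.cast_nonneg) ha.le
  antitone i j hij := Real.rpow_le_rpow_of_nonpos (by positivity) (by gcongr) ha.le
  tendsto_zero := by
    simpa only [neg_neg, Function.comp_def] using
      (tendsto_rpow_neg_atTop (neg_pos.2 ha)).comp (tendsto_natCast_add_atTop 1)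

theorem isScale_inv : IsScale fun j => ((j : ℝ) + 1)⁻¹ := by
  simpa only [Real.rpow_neg_one] using isScale_rpow neg_one_lt_zero

theorem log_natCast_add_two_pos (j : ℕ) : 0 < Real.log ((j : ℝ) + 2) :=
  Real.log_pos (by linarith [j.cast_nonneg (α := ℝ)])

theorem isScale_inv_mul_log : IsScale fun j => (((j : ℝ) + 2) * Real.log (j + 2))⁻¹ := by
  have hmono : Monotone fun j : ℕ => ((j : ℝ) + 2) * Real.log (j + 2) := fun i j hij => by
    have := (log_natCast_add_two_pos i).le
    dsimp only
    gcongr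
  have hpos : ∀ j : ℕ, 0 < ((j : ℝ) + 2) * Real.log (j + 2) := fun j =>
    mul_pos (by positivity) (log_natCast_add_two_pos j)
  refine ⟨fun j => inv_pos.2 (hpos j), fun j => inv_le_one_of_one_le₀ ?_,
    fun i j hij => inv_anti₀ (hpos i) (hmono hij), ?_⟩
  · refine le_trans ?_ (hmono j.zero_le)
    norm_num
    linarith [Real.log_two_gt_d9]
  · exact tendsto_inv_atTop_zero.comp ((tendsto_natCast_add_atTop 2).atTop_mul_atTop₀
      (Real.tendsto_log_atTop.comp (tendsto_natCast_add_atTop 2)))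

theorem tendsto_sum_inv :
    Tendsto (fun n : ℕ => ∑ j ∈ Finset.Icc 1 n, ((j : ℝ) + 1)⁻¹) atTop atTop :=
  tendsto_atTop_mono (fun n => log_sub_log_le_sum_inv n.zero_le)
    (tendsto_atTop_add_const_right _ (-Real.log ((0 : ℕ) + 2))
      (Real.tendsto_log_atTop.comp (tendsto_natCast_add_atTop 2)))

theorem tendsto_sum_inv_mul_log :
    Tendsto (fun n : ℕ => ∑ j ∈ Finset.Icc 1 n, (((j : ℝ) + 2) * Real.log (j + 2))⁻¹) atTop atTop :=
  tendsto_atTop_mono log_log_sub_le_sum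
    (tendsto_atTop_add_const_right _ (-Real.log (Real.log 3))
      (Real.tendsto_log_atTop.comp (Real.tendsto_log_atTop.comp (tendsto_natCast_add_atTop 3))))

theorem tendsto_sum_rpow {η : ℝ} (hη₀ : 0 < η) (hη₁ : η ≤ 1) :
    Tendsto (fun n : ℕ => ∑ j ∈ Finset.Icc 1 n, ((j : ℝ) + 1) ^ (η - 1)) atTop atTop := by
  refine tendsto_atTop_mono' _ ?_
    (((tendsto_rpow_atTop hη₀).comp (tendsto_natCast_add_atTop 1)).atTop_div_const four_pos)
  filter_upwards [eventually_ge_atTop 1] with n hn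
  exact (le_sum_Ioc_half_rpow hη₁ hn).trans (Finset.sum_le_sum_of_subset_of_nonneg
    (Finset.Ioc_subset_Ioc_left (Nat.zero_le _)) fun _ _ _ => by positivity)

end Sums

section LowerBounds

open Asymptotics

theorem ofReal_le_liminf_div {u : ℕ → ℝ≥0∞} {b : ℕ → ℝ} {a : ℝ} (ha : 0 ≤ a)
    (hb : ∀ᶠ n in atTop, 0 < b n) (h : ∀ᶠ n in atTop, ENNReal.ofReal (a * b n) ≤ u n) :
    ENNReal.ofReal a ≤ liminf (fun n => u n / ENNReal.ofReal (b n)) atTop := by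
  refine le_liminf_of_le (by isBoundedDefault) ?_
  filter_upwards [hb, h] with n hbn hn
  rwa [ENNReal.le_div_iff_mul_le (Or.inl (ENNReal.ofReal_pos.2 hbn).ne')
    (Or.inl ENNReal.ofReal_ne_top), ← ENNReal.ofReal_mul ha]

variable {X : Type*} [MetricSpace X] [MeasurableSpace X] {T : X → X} {μ : Measure X} {p : X}
  {d k c C : ℝ}

theorem IsRegularAt.ae_eventually_le_hits_sub_half (h : IsRegularAt μ p d c C) (hd : 0 < d)
    (hSBC : SBCAt T μ p) {η : ℝ} (hη₀ : 0 < η) (hη₁ : η < 1) :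
    ∀ᵐ x ∂μ, ∀ᶠ n : ℕ in atTop, c * (((n : ℝ) + 1) ^ η / 4) / 2 ≤
      hits T (scaleBall p d fun j => ((j : ℝ) + 1) ^ (η - 1)) n x -
        hits T (scaleBall p d fun j => ((j : ℝ) + 1) ^ (η - 1)) (n / 2) x := by
  have hc : 0 < c := h.pos
  have hv : IsScale fun j => ((j : ℝ) + 1) ^ (η - 1) := isScale_rpow (sub_neg.2 hη₁)
  set B := scaleBall p d fun j => ((j : ℝ) + 1) ^ (η - 1)
  have hE : expectedHits μ B =O[atTop] fun n : ℕ => c * (((n : ℝ) + 1) ^ η / 4) := by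
    refine IsBigO.of_bound (C * η⁻¹ / (c / 4)) (Eventually.of_forall fun n => ?_)
    rw [Real.norm_of_nonneg (expectedHits_nonneg n), Real.norm_of_nonneg (by positivity)]
    refine ((h.expectedHits_le hd hv n).trans (mul_le_mul_of_nonneg_left
      (sum_rpow_le hη₀ hη₁.le n) h.upper_pos.le)).trans_eq ?_
    field_simp
  filter_upwards [hSBC B (hv.nestedBalls hd)
    (h.tendsto_expectedHits hd hv (tendsto_sum_rpow hη₀ hη₁.le))] with x hx
  refine eventually_half_le_hits_sub (μ := μ) (Eventually.of_forall fun n => by positivity) ?_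
    ((isLittleO_comp_sub_comp monotone_expectedHits expectedHits_nonneg hx
      (Nat.tendsto_div_const_atTop two_ne_zero) tendsto_id
      (Eventually.of_forall fun n => Nat.div_le_self n 2)).trans_isBigO hE)
  filter_upwards [eventually_ge_atTop 1] with n hn
  exact (mul_le_mul_of_nonneg_left (le_sum_Ioc_half_rpow hη₁.le hn) hc.le).trans
    (h.le_expectedHits_sub hd hv (Nat.div_le_self n 2))

theorem IsRegularAt.exists_ae_eventually_ofReal_mul_rpow_le_S (h : IsRegularAt μ p d c C)
    (hd : 0 < d) (hk : 0 ≤ k) (hSBC : SBCAt T μ p) {η : ℝ} (hη₀ : 0 < η) (hη₁ : η < 1) :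
    ∃ δ : ℝ, 0 < δ ∧ ∀ᵐ x ∂μ, ∀ᶠ n : ℕ in atTop,
      ENNReal.ofReal (δ * (n : ℝ) ^ (η + (1 - η) * (k / d))) ≤ S T p k n x := by
  have hc : 0 < c := h.pos
  have : 0 < 1 - η := sub_pos.2 hη₁
  have hκ : 0 ≤ (1 - η) * (k / d) := by positivity
  have hv : IsScale fun j => ((j : ℝ) + 1) ^ (η - 1) := isScale_rpow (sub_neg.2 hη₁)
  refine ⟨c / 8 * (1 / 2) ^ ((1 - η) * (k / d)), by positivity, ?_⟩
  filter_upwards [h.ae_eventually_le_hits_sub_half hd hSBC hη₀ hη₁] with x hx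
  rw [← map_add_atTop_eq_nat 1, eventually_map]
  filter_upwards [hx] with n hn
  refine le_trans (ENNReal.ofReal_le_ofReal ?_)
    (hv.ofReal_hits_sub_mul_le_S hd.le hk (Nat.div_le_self n 2) x)
  have hscale : (((n : ℝ) + 1) / 2) ^ ((1 - η) * (k / d)) ≤
      (((n / 2 : ℕ) + 1 : ℝ) ^ (η - 1)) ^ (-(k / d)) := by
    rw [← Real.rpow_mul (by positivity), mul_neg, ← neg_mul, neg_sub]
    refine Real.rpow_le_rpow (by positivity) ?_ hκ
    rw [div_le_iff₀ two_pos]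
    exact_mod_cast (by omega : n + 1 ≤ (n / 2 + 1) * 2)
  calc c / 8 * (1 / 2) ^ ((1 - η) * (k / d)) * ((n + 1 : ℕ) : ℝ) ^ (η + (1 - η) * (k / d))
      = c * (((n : ℝ) + 1) ^ η / 4) / 2 * (((n : ℝ) + 1) / 2) ^ ((1 - η) * (k / d)) := by
        rw [Nat.cast_add_one, Real.rpow_add (by positivity), div_eq_mul_one_div ((n : ℝ) + 1),
          Real.mul_rpow (by positivity) (by positivity)]
        ring
    _ ≤ _ := mul_le_mul hn hscale (by positivity) (le_trans (by positivity) hn)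

theorem IsRegularAt.ae_one_le_liminf_S_div (h : IsRegularAt μ p d c C) (hd : 0 < d) (hk : 0 < k)
    (hSBC : SBCAt T μ p) {ε : ℝ} (hε : 0 < ε) :
    ∀ᵐ x ∂μ, 1 ≤ liminf (fun n : ℕ => S T p k n x /
      ENNReal.ofReal ((n : ℝ) ^ (k / d - ε))) atTop := by
  have hκ : 0 < k / d := by positivity
  obtain ⟨η, hη₀, hη⟩ := exists_between (lt_min one_pos (div_pos hε hκ))
  have hηκ : η * (k / d) < ε := (lt_div_iff₀ hκ).1 (hη.trans_le (min_le_right _ _))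
  have hexp : k / d - ε < η + (1 - η) * (k / d) := by linarith
  obtain ⟨δ, hδ, hae⟩ := h.exists_ae_eventually_ofReal_mul_rpow_le_S hd hk.le hSBC hη₀
    (hη.trans_le (min_le_left _ _))
  filter_upwards [hae] with x hx
  rw [← ENNReal.ofReal_one]
  refine ofReal_le_liminf_div zero_le_one ?_ ?_
  · filter_upwards [eventually_gt_atTop 0] with n hn
    positivity
  · have hlittle := (isLittleO_rpow_rpow_atTop_of_lt hexp).comp_tendsto
      tendsto_natCast_atTop_atTop
    filter_upwards [hx, hlittle.bound hδ] with n hn hbound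
    refine (ENNReal.ofReal_le_ofReal ?_).trans hn
    simpa [Real.norm_of_nonneg (Real.rpow_nonneg n.cast_nonneg _)] using hbound

theorem IsRegularAt.exists_ae_lt_liminf_S_div (h : IsRegularAt μ p d c C) (hd : 0 < d)
    (hk : d ≤ k) (hSBC : SBCAt T μ p) :
    ∃ δ : ℝ, 0 < δ ∧ ∀ᵐ x ∂μ, ENNReal.ofReal δ <
      liminf (fun n : ℕ => S T p k n x / (n : ℝ≥0∞)) atTop := by
  obtain ⟨δ, hδ, hae⟩ := h.exists_ae_eventually_ofReal_mul_rpow_le_S hd (hd.le.trans hk) hSBC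
    one_half_pos one_half_lt_one
  refine ⟨δ / 2, half_pos hδ, ?_⟩
  filter_upwards [hae] with x hx
  refine ((ENNReal.ofReal_lt_ofReal_iff hδ).2 (half_lt_self hδ)).trans_le ?_
  simp only [← ENNReal.ofReal_natCast]
  refine ofReal_le_liminf_div hδ.le ?_ ?_
  · filter_upwards [eventually_gt_atTop 0] with n hn
    exact Nat.cast_pos.2 hn
  · filter_upwards [hx, eventually_ge_atTop 1] with n hn hn₁
    refine (ENNReal.ofReal_le_ofReal (mul_le_mul_of_nonneg_left ?_ hδ.le)).trans hn
    refine Real.self_le_rpow_of_one_le (Nat.one_le_cast.2 hn₁) ?_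
    linarith [(one_le_div hd).2 hk]

theorem IsRegularAt.ae_frequently_le_S (h : IsRegularAt μ p d c C) (hd : 0 < d) (hk : 0 ≤ k)
    (hSBC : SBCAt T μ p) :
    ∀ᵐ x ∂μ, ∃ᶠ n : ℕ in atTop,
      ENNReal.ofReal ((n : ℝ) ^ (k / d) * Real.log n ^ (k / d)) ≤ S T p k n x := by
  have hv := isScale_inv_mul_log
  set B := scaleBall p d fun j => (((j : ℝ) + 2) * Real.log (j + 2))⁻¹
  have hE : Tendsto (expectedHits μ B) atTop atTop :=
    h.tendsto_expectedHits hd hv tendsto_sum_inv_mul_log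
  filter_upwards [hSBC B (hv.nestedBalls hd) hE] with x hx
  refine frequently_atTop.2 fun N => ?_
  obtain ⟨n, hn, hNn⟩ := (((tendsto_hits_atTop hE hx).eventually_gt_atTop (hits T B N x)).and
    (eventually_ge_atTop N)).exists
  obtain ⟨j, hj, hjB⟩ := exists_mem_of_hits_lt_hits hNn hn
  refine ⟨j + 1, (Finset.mem_Ioc.1 hj).1.le.trans j.le_succ, le_trans (ENNReal.ofReal_le_ofReal ?_)
    ((ofReal_rpow_le_obs hd.le hk (hv.pos j) le_rfl hjB).trans (obs_iterate_le_S j.lt_succ_self))⟩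
  have hlog₂ := log_natCast_add_two_pos j
  have hlog₁ : 0 ≤ Real.log ((j : ℝ) + 1) :=
    Real.log_nonneg (le_add_of_nonneg_left j.cast_nonneg)
  rw [Real.inv_rpow (by positivity), Real.rpow_neg (by positivity), inv_inv, Nat.cast_add_one,
    ← Real.mul_rpow (by positivity) hlog₁]
  gcongr <;> norm_num

end LowerBounds

section QuantitativeLowerBound

open Asymptotics

/-- The time `t * exp (-(log t) ^ a / 2)`. Harmonic sums between this time and `t` are of order
`(log t) ^ a`, which for `a > 1 / 2` exceeds the error in the QSBC property. -/
def earlierTime (a t : ℝ) : ℝ :=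
  t * Real.exp (-(Real.log t ^ a / 2))

theorem earlierTime_pos {a t : ℝ} (ht : 0 < t) : 0 < earlierTime a t :=
  mul_pos ht (Real.exp_pos _)

theorem log_earlierTime {a t : ℝ} (ht : 0 < t) :
    Real.log (earlierTime a t) = Real.log t - Real.log t ^ a / 2 := by
  rw [earlierTime, Real.log_mul ht.ne' (Real.exp_ne_zero _), Real.log_exp, sub_eq_add_neg]

theorem earlierTime_lt {a t : ℝ} (ht : 1 < t) : earlierTime a t < t := by
  have hlog : 0 < Real.log t := Real.log_pos ht
  exact mul_lt_of_lt_one_right (by linarith)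
    (Real.exp_lt_one_iff.2 (neg_lt_zero.2 (by positivity)))

theorem tendsto_earlierTime {a : ℝ} (ha : a ≤ 1) : Tendsto (earlierTime a) atTop atTop := by
  refine tendsto_atTop_mono' _ ?_ (Real.tendsto_exp_atTop.comp
    (Real.tendsto_log_atTop.atTop_div_const two_pos))
  filter_upwards [eventually_gt_atTop 0, Real.tendsto_log_atTop.eventually_ge_atTop 1]
    with t ht hlog
  have hpow : Real.log t ^ a ≤ Real.log t := Real.rpow_le_self_of_one_le hlog ha
  rw [Function.comp_apply, ← Real.le_log_iff_exp_le (earlierTime_pos ht), log_earlierTime ht]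
  linarith

theorem isBigO_log_sub_log_earlierTime {a : ℝ} (ha₀ : 0 < a) (ha₁ : a ≤ 1) :
    (fun t : ℝ => Real.log t ^ a) =O[atTop]
      fun t => Real.log (t + 1) - Real.log (⌊earlierTime a t⌋₊ + 2) := by
  refine IsBigO.of_bound 4 ?_
  filter_upwards [eventually_gt_atTop 1, (tendsto_earlierTime ha₁).eventually_ge_atTop 2,
    ((tendsto_rpow_atTop ha₀).comp Real.tendsto_log_atTop).eventually_ge_atTop (4 * Real.log 2)]
    with t ht hy hlarge
  rw [Function.comp_apply] at hlarge
  have ht₀ : 0 < t := one_pos.trans ht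
  have hlog : 0 < Real.log t := Real.log_pos ht
  have hfloor : Real.log (⌊earlierTime a t⌋₊ + 2) ≤ Real.log (2 * earlierTime a t) :=
    Real.log_le_log (by positivity) (by linarith [Nat.floor_le (earlierTime_pos (a := a) ht₀).le])
  rw [Real.log_mul two_ne_zero (earlierTime_pos ht₀).ne', log_earlierTime ht₀] at hfloor
  have hsucc : Real.log t ≤ Real.log (t + 1) := Real.log_le_log ht₀ (by linarith)
  have hpow : 0 < Real.log t ^ a := by positivity
  rw [Real.norm_of_nonneg hpow.le, Real.norm_of_nonneg (by linarith)]
  linarith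

variable {X : Type*} [MetricSpace X] [MeasurableSpace X] {T : X → X} {μ : Measure X} {p : X}
  {d k c C : ℝ}

theorem IsRegularAt.ae_eventually_hits_lt_hits (h : IsRegularAt μ p d c C) (hd : 0 < d)
    (hQ : QSBCAt T μ p) {δ : ℝ} (hδ : 0 < δ) {m : ℕ → ℕ} (hm : Tendsto m atTop atTop)
    (hmn : ∀ᶠ n in atTop, m n ≤ n)
    (hlog : (fun n : ℕ => Real.log (n + 1) ^ (1 / 2 + δ)) =o[atTop]
      fun n => Real.log (n + 2) - Real.log (m n + 2)) :
    ∀ᵐ x ∂μ, ∀ᶠ n in atTop, hits T (scaleBall p d fun j => ((j : ℝ) + 1)⁻¹) (m n) x <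
      hits T (scaleBall p d fun j => ((j : ℝ) + 1)⁻¹) n x := by
  have hc : 0 < c := h.pos
  have hv := isScale_inv
  set B := scaleBall p d fun j => ((j : ℝ) + 1)⁻¹
  have hlog_nonneg : ∀ n : ℕ, 0 ≤ Real.log ((n : ℝ) + 1) := fun n =>
    Real.log_nonneg (le_add_of_nonneg_left n.cast_nonneg)
  have hE : (fun n => expectedHits μ B n ^ (1 / 2 + δ)) =O[atTop]
      fun n : ℕ => Real.log (n + 1) ^ (1 / 2 + δ) := by
    refine IsBigO.rpow (by positivity) (Eventually.of_forall hlog_nonneg)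
      (IsBigO.of_bound C (Eventually.of_forall fun n => ?_))
    rw [Real.norm_of_nonneg (expectedHits_nonneg n), Real.norm_of_nonneg (hlog_nonneg n)]
    exact (h.expectedHits_le hd hv n).trans
      (mul_le_mul_of_nonneg_left (sum_inv_le_log n) h.upper_pos.le)
  have hpos : ∀ᶠ n : ℕ in atTop, 0 < Real.log ((n : ℝ) + 2) - Real.log (m n + 2) := by
    filter_upwards [hlog.bound one_pos, hmn, eventually_gt_atTop 0] with n hbound hmn hn
    have hlogn : 0 < Real.log ((n : ℝ) + 1) := Real.log_pos (by simpa using hn)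
    have hmono : Real.log ((m n : ℝ) + 2) ≤ Real.log (n + 2) :=
      Real.log_le_log (by positivity) (by gcongr)
    rw [one_mul, Real.norm_of_nonneg (by positivity), Real.norm_of_nonneg (sub_nonneg.2 hmono)]
      at hbound
    exact (Real.rpow_pos_of_pos hlogn _).trans_le hbound
  filter_upwards [hQ B (hv.nestedBalls hd) (h.tendsto_expectedHits hd hv tendsto_sum_inv) δ hδ]
    with x hx
  have herror := ((isBigO_comp_sub_comp
    (fun i j hij => Real.rpow_le_rpow (expectedHits_nonneg i) (monotone_expectedHits hij)
      (by positivity)) (fun n => Real.rpow_nonneg (expectedHits_nonneg n) _) hx hm tendsto_id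
      hmn).trans hE).trans_isLittleO (hlog.const_mul_right hc.ne')
  have hgain := eventually_half_le_hits_sub (hpos.mono fun n hn => (mul_pos hc hn).le)
    (hmn.mono fun n hn => (mul_le_mul_of_nonneg_left (log_sub_log_le_sum_inv hn) hc.le).trans
      (h.le_expectedHits_sub hd hv hn)) herror
  filter_upwards [hgain, hpos] with n hn hposn
  exact sub_pos.1 ((half_pos (mul_pos hc hposn)).trans_le hn)

theorem IsRegularAt.ae_eventually_ofReal_earlierTime_rpow_le_S (h : IsRegularAt μ p d c C)
    (hd : 0 < d) (hk : 0 ≤ k) (hQ : QSBCAt T μ p) {a : ℝ} (ha₀ : 1 / 2 < a) (ha₁ : a ≤ 1) :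
    ∀ᵐ x ∂μ, ∀ᶠ n : ℕ in atTop,
      ENNReal.ofReal (earlierTime a n ^ (k / d)) ≤ S T p k n x := by
  obtain ⟨b, hb₀, hb₁⟩ := exists_between ha₀
  have hsucc : Tendsto (fun n : ℕ => (n : ℝ) + 1) atTop atTop := tendsto_natCast_add_atTop 1
  set m : ℕ → ℕ := fun n => ⌊earlierTime a ((n : ℝ) + 1)⌋₊
  have hm : Tendsto m atTop atTop :=
    tendsto_nat_floor_atTop.comp ((tendsto_earlierTime ha₁).comp hsucc)
  have hmn : ∀ᶠ n in atTop, m n ≤ n := by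
    filter_upwards [eventually_gt_atTop 0] with n hn
    refine Nat.lt_succ_iff.1 ((Nat.floor_lt (earlierTime_pos (by positivity)).le).2 ?_)
    rw [Nat.cast_succ]
    exact earlierTime_lt (by simpa using hn)
  have hlog : (fun n : ℕ => Real.log (n + 1) ^ (1 / 2 + (b - 1 / 2))) =o[atTop]
      fun n => Real.log (n + 2) - Real.log (m n + 2) := by
    have hpow := (isLittleO_rpow_rpow_atTop_of_lt hb₁).comp_tendsto Real.tendsto_log_atTop
    refine ((hpow.trans_isBigO (isBigO_log_sub_log_earlierTime (by linarith) ha₁)).comp_tendsto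
      hsucc).congr (fun n => ?_) fun n => ?_
    · simp only [Function.comp_apply, add_sub_cancel]
    · simp only [Function.comp_apply, m, add_assoc, one_add_one_eq_two]
  filter_upwards [h.ae_eventually_hits_lt_hits hd hQ (sub_pos.2 hb₀) hm hmn hlog] with x hx
  rw [← map_add_atTop_eq_nat 1, eventually_map]
  filter_upwards [hx, hmn] with n hn hmn
  obtain ⟨j, hj, hjB⟩ := exists_mem_of_hits_lt_hits hmn hn
  rw [Finset.mem_Ioc] at hj
  refine le_trans (ENNReal.ofReal_le_ofReal ?_)
    ((ofReal_rpow_le_obs hd.le hk (isScale_inv.pos j) (isScale_inv.antitone hj.1.le) hjB).trans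
      (obs_iterate_le_S (Nat.lt_succ_iff.2 hj.2)))
  rw [Real.inv_rpow (by positivity), Real.rpow_neg (by positivity), inv_inv, Nat.cast_add_one]
  exact Real.rpow_le_rpow (earlierTime_pos (by positivity)).le (Nat.lt_floor_add_one _).le
    (by positivity)

theorem eventually_two_mul_exp_le_earlierTime {ε : ℝ} (hε : 0 < ε) :
    ∀ᶠ t : ℝ in atTop,
      2 * (t * Real.exp (-(Real.log t) ^ (1 / 2 + ε))) ≤ earlierTime (min (1 / 2 + ε) 1) t := by
  filter_upwards [eventually_gt_atTop 0, Real.tendsto_log_atTop.eventually_ge_atTop 1,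
    ((tendsto_rpow_atTop (by positivity : 0 < 1 / 2 + ε)).comp
      Real.tendsto_log_atTop).eventually_ge_atTop (2 * Real.log 2)] with t ht hlog hlarge
  rw [Function.comp_apply] at hlarge
  have hpow : Real.log t ^ min (1 / 2 + ε) 1 ≤ Real.log t ^ (1 / 2 + ε) :=
    Real.rpow_le_rpow_of_exponent_le hlog (min_le_left _ _)
  rw [← Real.log_le_log_iff (by positivity) (earlierTime_pos ht), log_earlierTime ht,
    Real.log_mul two_ne_zero (by positivity), Real.log_mul ht.ne' (Real.exp_ne_zero _),
    Real.log_exp]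
  linarith

theorem IsRegularAt.ae_one_lt_liminf_S_div (h : IsRegularAt μ p d c C) (hd : 0 < d) (hk : 0 < k)
    (hQ : QSBCAt T μ p) {ε : ℝ} (hε : 0 < ε) :
    ∀ᵐ x ∂μ, 1 < liminf (fun n : ℕ => S T p k n x /
      ENNReal.ofReal ((n : ℝ) ^ (k / d) *
        Real.exp (-(Real.log n) ^ (1 / 2 + ε)) ^ (k / d))) atTop := by
  have hκ : 0 < k / d := by positivity
  filter_upwards [h.ae_eventually_ofReal_earlierTime_rpow_le_S hd hk.le hQ
    (lt_min (lt_add_of_pos_right _ hε) one_half_lt_one) (min_le_right (1 / 2 + ε) 1)] with x hx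
  refine (ENNReal.one_lt_ofReal.2 (Real.one_lt_rpow one_lt_two hκ)).trans_le
    (ofReal_le_liminf_div (by positivity) ?_ ?_)
  · filter_upwards [eventually_gt_atTop 0] with n hn
    positivity
  · filter_upwards [hx, tendsto_natCast_atTop_atTop.eventually
      (eventually_two_mul_exp_le_earlierTime hε)] with n hn hle
    refine (ENNReal.ofReal_le_ofReal ?_).trans hn
    rw [← Real.mul_rpow n.cast_nonneg (Real.exp_pos _).le,
      ← Real.mul_rpow two_pos.le (by positivity)]
    exact Real.rpow_le_rpow (by positivity) hle hκ.le

end QuantitativeLowerBound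

end BirkhoffGrowth

theorem theorem1_general {X : Type*} [MetricSpace X] [MeasurableSpace X] [BorelSpace X] {T : X → X}
    {μ : Measure X} [IsFiniteMeasure μ] (hT : MeasurePreserving T μ μ) {p : X} {d k : ℝ}
    (hd : 0 < d) (hk : 0 < k)
    (hμ : (fun r => μ.real (Metric.ball p r)) =Θ[𝓝[>] 0] fun r => r ^ d)
    (hSBC : BirkhoffGrowth.SBCAt T μ p) :
    (d ≤ k → ∀ ε : ℝ, 0 < ε → ∀ᵐ x ∂μ,
      limsup (fun n : ℕ => BirkhoffGrowth.S T p k n x /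
        ENNReal.ofReal ((n : ℝ) ^ (k / d) * Real.log n ^ (k / d + ε))) atTop = 0) ∧
    (∀ ε : ℝ, 0 < ε → ∀ᵐ x ∂μ,
      1 ≤ liminf (fun n : ℕ => BirkhoffGrowth.S T p k n x /
        ENNReal.ofReal ((n : ℝ) ^ (k / d - ε))) atTop) ∧
    (∀ᵐ x ∂μ, ∃ᶠ n : ℕ in atTop,
      ENNReal.ofReal ((n : ℝ) ^ (k / d) * Real.log n ^ (k / d)) ≤ BirkhoffGrowth.S T p k n x) ∧
    (BirkhoffGrowth.QSBCAt T μ p → ∀ ε : ℝ, 0 < ε → ∀ᵐ x ∂μ,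
      1 < liminf (fun n : ℕ => BirkhoffGrowth.S T p k n x /
        ENNReal.ofReal ((n : ℝ) ^ (k / d) *
          Real.exp (-(Real.log n) ^ (1 / 2 + ε)) ^ (k / d))) atTop) ∧
    (d ≤ k → ∃ δ : ℝ, 0 < δ ∧ ∀ᵐ x ∂μ,
      ENNReal.ofReal δ <
        liminf (fun n : ℕ => BirkhoffGrowth.S T p k n x / (n : ℝ≥0∞)) atTop) := by
  obtain ⟨c, C, h⟩ := BirkhoffGrowth.IsRegularAt.exists_of_isTheta hd.le hμ
  exact ⟨fun hdk ε hε => h.ae_limsup_S_div_eq_zero hd hdk hT hε,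
    fun ε hε => h.ae_one_le_liminf_S_div hd hk hSBC hε,
    h.ae_frequently_le_S hd hk.le hSBC,
    fun hQSBC ε hε => h.ae_one_lt_liminf_S_div hd hk hQSBC hε,
    fun hdk => h.exists_ae_lt_liminf_S_div hd hdk hSBC⟩

theorem theorem1
    {E : Type*} [NormedAddCommGroup E] [NormedSpace ℝ E]
    {H : Type*} [TopologicalSpace H] (I : ModelWithCorners ℝ E H)
    -- `X` is a Riemannian manifold of dimension `D`, with its Riemannian distance
    {X : Type*} [MetricSpace X] [ChartedSpace H X] [IsManifold I 1 X]
    [RiemannianBundle (fun x : X => TangentSpace I x)]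
    [IsContinuousRiemannianBundle E (fun x : X => TangentSpace I x)]
    [IsRiemannianManifold I X]
    (D : ℕ) (hD : 0 < D) (hdim : Module.finrank ℝ E = D)
    -- the ergodic system `(T, X, μ)`
    [MeasurableSpace X] [BorelSpace X]
    (T : X → X) (μ : Measure X) [IsProbabilityMeasure μ] (hT : Ergodic T μ)
    (p : X) (k : ℝ)
    -- the density at `p`, with respect to the `D`-dimensional Riemannian volume, lies in `(C₁, C₂)`
    (C₁ C₂ : ℝ) (hC₁ : 0 < C₁)
    (hlower : ENNReal.ofReal C₁ < BirkhoffGrowth.lowerDensity μ (μHE[D]) p)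
    (hupper : BirkhoffGrowth.upperDensity μ (μHE[D]) p < ENNReal.ofReal C₂)
    (hSBC : BirkhoffGrowth.SBCAt T μ p) :
    ((D : ℝ) < k →
      (∀ ε : ℝ, 0 < ε → ∀ᵐ x ∂μ,
        limsup (fun n : ℕ => BirkhoffGrowth.S T p k n x /
          ENNReal.ofReal ((n : ℝ) ^ (k / D) * Real.log n ^ (k / D + ε))) atTop = 0) ∧
      (∀ ε : ℝ, 0 < ε → ∀ᵐ x ∂μ,
        1 ≤ liminf (fun n : ℕ => BirkhoffGrowth.S T p k n x /
          ENNReal.ofReal ((n : ℝ) ^ (k / D - ε))) atTop) ∧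
      (∀ᵐ x ∂μ, ∃ᶠ n : ℕ in atTop,
        ENNReal.ofReal ((n : ℝ) ^ (k / D) * Real.log n ^ (k / D)) ≤
          BirkhoffGrowth.S T p k n x) ∧
      (BirkhoffGrowth.QSBCAt T μ p → ∀ ε : ℝ, 0 < ε → ∀ᵐ x ∂μ,
        1 < liminf (fun n : ℕ => BirkhoffGrowth.S T p k n x /
          ENNReal.ofReal ((n : ℝ) ^ (k / D) *
            Real.exp (-(Real.log n) ^ (1 / 2 + ε)) ^ (k / D))) atTop)) ∧
    (k = D →
      (∀ ε : ℝ, 0 < ε → ∀ᵐ x ∂μ,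
        limsup (fun n : ℕ => BirkhoffGrowth.S T p k n x /
          ENNReal.ofReal ((n : ℝ) ^ (k / D) * Real.log n ^ (k / D + ε))) atTop = 0) ∧
      (∀ᵐ x ∂μ, ∃ᶠ n : ℕ in atTop,
        ENNReal.ofReal ((n : ℝ) ^ (k / D) * Real.log n ^ (k / D)) ≤
          BirkhoffGrowth.S T p k n x) ∧
      (∃ δ : ℝ, 0 < δ ∧ ∀ᵐ x ∂μ,
        ENNReal.ofReal δ <
          liminf (fun n : ℕ => BirkhoffGrowth.S T p k n x / (n : ℝ≥0∞)) atTop)) := by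
  have hfin : Module.Finite ℝ E := Module.finite_of_finrank_pos (hdim ▸ hD)
  have hD₀ : (0 : ℝ) < D := Nat.cast_pos.2 hD
  have hμ : (fun r => μ.real (Metric.ball p r)) =Θ[𝓝[>] 0] fun r => r ^ (D : ℝ) := by
    have hvol := BirkhoffGrowth.isTheta_real_euclideanHausdorffMeasure_ball I p
    simp only [hdim, ← Real.rpow_natCast] at hvol
    exact (BirkhoffGrowth.isTheta_measureReal_ball_of_density (bot_le.trans_lt hlower)
      (hupper.trans ENNReal.ofReal_lt_top)).trans hvol
  have main := fun hk : (D : ℝ) ≤ k =>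
    theorem1_general hT.toMeasurePreserving hD₀ (hD₀.trans_le hk) hμ hSBC
  refine ⟨fun hk => ?_, fun hk => ?_⟩
  · obtain ⟨ha, hb, hc, hd, -⟩ := main hk.le
    exact ⟨ha hk.le, hb, hc, hd⟩
  · obtain ⟨ha, -, hc, -, hδ⟩ := main hk.ge
    exact ⟨ha hk.ge, hc, hδ hk.ge⟩
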